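/- Let $q:\mathbb R\to\mathbb R$ be locally integrable and suppose that the maximal operator $Ly=-y''+qy$ in $L^2(\mathbb R)$ (whose domain consists of the $y\in L^2(\mathbb R)$ such that $y,y'$ are locally absolutely continuous and $-y''+qy\in L^2(\mathbb R)$) is self-adjoint. Let $\operatorname{Re}\lambda_0>0$, $\operatorname{Im}\lambda_0>0$, $x_0>0$. For $\mu\in\{\lambda_0,-\bar\lambda_0\}$ let $e^-(\cdot,\mu)\in L^2(-\infty,0]$ and $e^+_{x_0}(\cdot,\mu)\in L^2[x_0,\infty)$ be solutions of $-y''+qy=\mu^2y$ on $(-\infty,0]$ and on $[x_0,\infty)$, respectively, of $L^2$-norm one; extended by zero they are regarded as elements of $L^2(\mathbb R)$. Let $c(x,\lambda),s(x,\lambda)$ be the solutions of $-y''+qy=\lambda^2y$ on $\mathbb R$ with $c(0)=1,\ \dot c(0)=0,\ s(0)=0,\ \dot s(0)=1$ (a dot denotes $d/dx$, one-sided at end points), and $$\mathfrak B_x(\lambda^2)=\begin{bmatrix}c(x,\lambda)&s(x,\lambda)\\ \dot c(x,\lambda)&\dot s(x,\lambda)\end{bmatrix},\qquad \frac{d}{dx}\mathfrak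 B_x(\lambda^2)=\begin{bmatrix}0&1\\ q(x)-\lambda^2&0\end{bmatrix}\mathfrak B_x(\lambda^2),\qquad \mathfrak B_0(\lambda^2)=I .$$ Then $c$ and $s$ exist for all $\lambda\in\mathbb C$, $L-\lambda_0^2$ maps the domain of $L$ bijectively onto $L^2(\mathbb R)$, and the Cayley transform $u=(L-\bar\lambda_0^2)(L-\lambda_0^2)^{-1}$ is unitary on $L^2(\mathbb R)$. With $K=L^2[0,x_0]$, the pairs $\big(e^-(\cdot,-\bar\lambda_0),\,e^+_{x_0}(\cdot,-\bar\lambda_0)\big)$ and $\big(e^+_{x_0}(\cdot,\lambda_0),\,e^-(\cdot,\lambda_0)\big)$ are orthonormal bases of subspaces $E_1$ and $E_2$ orthogonal to $K$, and $u$ restricts to a unitary operator $U:K\oplus E_1\to K\oplus E_2$ (the unitary node). Let $$\Theta(\zeta)=P_{E_2}U(I-\zeta P_KU)^{-1}|_{E_1}$$ be its characteristic function, $\theta(\zeta)=(\theta_{ij}(\zeta))_{i,j=1}^2$ the matrix of $\Theta(\zeta)$ in these (ordered) bases, and $$\mathfrak A(\zeta)=\begin{bmatrix}\theta_{11}&\theta_{12}\\0&1\end{bmatrix}\begin{bmatrix}1&0\\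 \theta_{21}&\theta_{22}\end{bmatrix}^{-1}(\zeta)$$ its transfer matrix. Put $\zeta=\frac{\lambda^2-\lambda_0^2}{\lambda^2-\bar\lambda_0^2}$ and $\mathfrak A_{x_0}(\lambda^2)=\mathfrak A(\zeta)$. The operator $I-\zeta P_KU$ is invertible whenever $|\zeta|<1$, in particular whenever $\operatorname{Im}\lambda^2>0$. For every $\lambda\in\mathbb C$ with $\lambda^2\ne\bar\lambda_0^2$ for which $I-\zeta P_KU$ is invertible, $\theta_{22}(\zeta)\neq0$ and $$\mathfrak A_{x_0}(\lambda^2)=\begin{bmatrix}e^+_{x_0}(x_0,\lambda_0)&-e^+_{x_0}(x_0,-\bar\lambda_0)\\ \dot e^+_{x_0}(x_0,\lambda_0)&-\dot e^+_{x_0}(x_0,-\bar\lambda_0)\end{bmatrix}^{-1}\mathfrak B_{x_0}(\lambda^2)\begin{bmatrix}-e^-(0,-\bar\lambda_0)&e^-(0,\lambda_0)\\-\dot e^-(0,-\bar\lambda_0)&\dot e^-(0,\lambda_0)\end{bmatrix},$$ the first matrix on the right being invertible. Moreover, for every $\lambda\in\mathbb C$ and all $c_1,c_2,d_1,d_2\in\mathbb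 C$, there is a $k\in K$ with $$u\big((\lambda^2-\lambda_0^2)k+c_1e^-(\cdot,-\bar\lambda_0)+d_2e^+_{x_0}(\cdot,-\bar\lambda_0)\big)=(\lambda^2-\bar\lambda_0^2)k+d_1e^+_{x_0}(\cdot,\lambda_0)+c_2e^-(\cdot,\lambda_0)$$ if and only if $\begin{bmatrix}d_1\\d_2\end{bmatrix}$ is the matrix on the right-hand side of the formula for $\mathfrak A_{x_0}(\lambda^2)$ applied to $\begin{bmatrix}c_1\\c_2\end{bmatrix}$. -/

import Mathlib

open MeasureTheory Set
open scoped ENNReal ComplexConjugate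

namespace SchrodingerNode

/-! ### Unitary nodes, characteristic functions and transfer matrices -/

section Node

variable {H : Type*} [NormedAddCommGroup H] [InnerProductSpace ℂ H]

/-- A unitary node: a unitary operator from `K ⊕ E₁` onto `K ⊕ E₂` (orthogonal sums), where `K` is a
closed subspace and `E₁`, `E₂` are finite-dimensional subspaces of a common inner product space. -/
structure UnitaryNode (H : Type*) [NormedAddCommGroup H] [InnerProductSpace ℂ H] where
  K : Submodule ℂ H
  E₁ : Submodule ℂ H
  E₂ : Submodule ℂ H
  [projK : K.HasOrthogonalProjection]
  [finE₁ : FiniteDimensional ℂ E₁]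
  [finE₂ : FiniteDimensional ℂ E₂]
  orth₁ : K ⟂ E₁
  orth₂ : K ⟂ E₂
  U : ↥(K ⊔ E₁) ≃ₗᵢ[ℂ] ↥(K ⊔ E₂)

attribute [instance] UnitaryNode.projK UnitaryNode.finE₁ UnitaryNode.finE₂

namespace UnitaryNode

/-- The operator `P_K U`, as an operator of `K ⊕ E₁` into itself. -/
noncomputable def compressed (N : UnitaryNode H) : ↥(N.K ⊔ N.E₁) →L[ℂ] ↥(N.K ⊔ N.E₁) :=
  (N.K.starProjection.comp
    ((N.K ⊔ N.E₂).subtypeL.comp (N.U : ↥(N.K ⊔ N.E₁) →L[ℂ] ↥(N.K ⊔ N.E₂)))).codRestrict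
    (N.K ⊔ N.E₁) fun _ =>
      (le_sup_left : N.K ≤ N.K ⊔ N.E₁) (Submodule.starProjection_apply_mem _ _)

/-- The pencil `I - ζ P_K U` on `K ⊕ E₁`. -/
noncomputable def pencil (N : UnitaryNode H) (ζ : ℂ) : ↥(N.K ⊔ N.E₁) →L[ℂ] ↥(N.K ⊔ N.E₁) :=
  1 - ζ • N.compressed

/-- The characteristic function `Θ(ζ) = P_{E₂} U (I - ζ P_K U)⁻¹ | E₁`
(meaningful when the pencil is invertible, in particular for `|ζ| < 1`). -/
noncomputable def charFun (N : UnitaryNode H) (ζ : ℂ) : N.E₁ →ₗ[ℂ] N.E₂ :=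
  (N.E₂.orthogonalProjectionOnto : H →ₗ[ℂ] N.E₂) ∘ₗ (N.K ⊔ N.E₂).subtype ∘ₗ
    N.U.toLinearEquiv.toLinearMap ∘ₗ
    (Ring.inverse (N.pencil ζ) : ↥(N.K ⊔ N.E₁) →ₗ[ℂ] ↥(N.K ⊔ N.E₁)) ∘ₗ
    Submodule.inclusion (le_sup_right : N.E₁ ≤ N.K ⊔ N.E₁)

/-- The matrix `θ(ζ)` of `Θ(ζ)` with respect to orthonormal bases of `E₁` and `E₂`. -/
noncomputable def charMatrix (N : UnitaryNode H) (b₁ : OrthonormalBasis (Fin 2) ℂ N.E₁)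
    (b₂ : OrthonormalBasis (Fin 2) ℂ N.E₂) (ζ : ℂ) : Matrix (Fin 2) (Fin 2) ℂ :=
  LinearMap.toMatrix b₁.toBasis b₂.toBasis (N.charFun ζ)

/-- The transfer matrix of the node: the Potapov-Ginzburg transform
`[θ₁₁ θ₁₂; 0 1] [1 0; θ₂₁ θ₂₂]⁻¹` of `θ(ζ)` (meaningful when `θ₂₂(ζ) ≠ 0`). -/
noncomputable def transferMatrix (N : UnitaryNode H) (b₁ : OrthonormalBasis (Fin 2) ℂ N.E₁)
    (b₂ : OrthonormalBasis (Fin 2) ℂ N.E₂) (ζ : ℂ) : Matrix (Fin 2) (Fin 2) ℂ :=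
  !![N.charMatrix b₁ b₂ ζ 0 0, N.charMatrix b₁ b₂ ζ 0 1; 0, 1] *
    (!![1, 0; N.charMatrix b₁ b₂ ζ 1 0, N.charMatrix b₁ b₂ ζ 1 1])⁻¹

end UnitaryNode

/-- The resolvent `(A - z)⁻¹` of a partially defined operator: `resolventOp A z f` is a solution `y`
in the domain of `A` of `A y - z y = f`. -/
noncomputable def resolventOp (A : H →ₗ.[ℂ] H) (z : ℂ) (f : H) : H :=
  open Classical in
  if h : ∃ y : A.domain, A y - z • (y : H) = f then (h.choose : H) else 0

/-- The Cayley transform `(A - z̄)(A - z)⁻¹ = I + (z - z̄)(A - z)⁻¹`. -/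
noncomputable def cayley (A : H →ₗ.[ℂ] H) (z : ℂ) (f : H) : H :=
  f + (z - conj z) • resolventOp A z f

end Node

/-! ### The Schrödinger operator on the line -/

/-- The complex Hilbert space `L²(ℝ)`. -/
abbrev L2 : Type := Lp ℂ 2 (volume : Measure ℝ)

/-- The graph of the maximal operator `y ↦ -y'' + q y` in `L²(ℝ)`: pairs `(y, g)` such that `y` has a
differentiable representative `φ` whose derivative is locally absolutely continuous, with
`φ'' = q φ - g` almost everywhere. -/
noncomputable def schrodingerGraph (q : ℝ → ℝ) : Submodule ℂ (L2 × L2) where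
  carrier := {p | ∃ φ : ℝ → ℂ, (p.1 : ℝ → ℂ) =ᵐ[volume] φ ∧ Differentiable ℝ φ ∧
    ∀ a b : ℝ, IntervalIntegrable (fun t => (q t : ℂ) * φ t - p.2 t) volume a b ∧
      deriv φ b - deriv φ a = ∫ t in a..b, ((q t : ℂ) * φ t - p.2 t)}
  zero_mem' := by
    refine ⟨0, Lp.coeFn_zero _ _ _, differentiable_const _, fun a b => ?_⟩
    have h : (fun t => (q t : ℂ) * (0 : ℝ → ℂ) t - ((0 : L2 × L2).2 : ℝ → ℂ) t)
        =ᵐ[volume] fun _ => 0 := by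
      filter_upwards [Lp.coeFn_zero ℂ 2 (volume : Measure ℝ)] with t ht
      change (q t : ℂ) * 0 - ((0 : L2) : ℝ → ℂ) t = 0
      rw [ht]; simp
    refine ⟨(intervalIntegrable_const (c := (0 : ℂ))).congr_ae (ae_restrict_of_ae h.symm), ?_⟩
    rw [intervalIntegral.integral_congr_ae (h.mono fun _ ht _ => ht)]
    have : deriv (0 : ℝ → ℂ) = 0 := by
      funext t; exact deriv_const t (0 : ℂ)
    simp [this]
  add_mem' := by
    rintro ⟨y, g⟩ ⟨y', g'⟩ ⟨φ, h1, h2, h3⟩ ⟨φ', h1', h2', h3'⟩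
    refine ⟨φ + φ', ?_, h2.add h2', fun a b => ?_⟩
    · exact (Lp.coeFn_add y y').trans (h1.add h1')
    · have h : (fun t => ((q t : ℂ) * φ t - g t) + ((q t : ℂ) * φ' t - g' t))
          =ᵐ[volume] fun t => (q t : ℂ) * (φ + φ') t - (g + g' : L2) t := by
        filter_upwards [Lp.coeFn_add g g'] with t ht
        rw [ht]; simp only [Pi.add_apply]; ring
      refine ⟨((h3 a b).1.add (h3' a b).1).congr_ae (ae_restrict_of_ae h), ?_⟩
      change _ = ∫ t in a..b, ((q t : ℂ) * (φ + φ') t - (g + g' : L2) t)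
      rw [← intervalIntegral.integral_congr_ae (h.mono fun _ ht _ => ht),
        intervalIntegral.integral_add (h3 a b).1 (h3' a b).1]
      have e1 := (h3 a b).2
      have e2 := (h3' a b).2
      simp only at e1 e2
      rw [← e1, ← e2, deriv_add (h2 b) (h2' b), deriv_add (h2 a) (h2' a)]
      ring
  smul_mem' := by
    rintro c ⟨y, g⟩ ⟨φ, h1, h2, h3⟩
    refine ⟨c • φ, ?_, h2.const_smul c, fun a b => ?_⟩
    · exact (Lp.coeFn_smul c y).trans (h1.const_smul c)
    · have h : (fun t => c * ((q t : ℂ) * φ t - g t))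
          =ᵐ[volume] fun t => (q t : ℂ) * (c • φ) t - (c • g : L2) t := by
        filter_upwards [Lp.coeFn_smul c g] with t ht
        rw [ht]; simp only [Pi.smul_apply, smul_eq_mul]; ring
      refine ⟨((h3 a b).1.const_mul c).congr_ae (ae_restrict_of_ae h), ?_⟩
      change _ = ∫ t in a..b, ((q t : ℂ) * (c • φ) t - (c • g : L2) t)
      rw [← intervalIntegral.integral_congr_ae (h.mono fun _ ht _ => ht),
        intervalIntegral.integral_const_mul]
      have e1 := (h3 a b).2
      simp only at e1
      rw [← e1, deriv_const_smul c (h2 b), deriv_const_smul c (h2 a)]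
      simp only [smul_eq_mul]
      ring

/-- The graph is single-valued, so that it is the graph of an operator. -/
theorem schrodingerGraph_single_valued (q : ℝ → ℝ) (p : L2 × L2) (hp : p ∈ schrodingerGraph q)
    (h0 : p.1 = 0) : p.2 = 0 := by
  obtain ⟨y, g⟩ := p
  obtain ⟨φ, h1, h2, h3⟩ := hp
  simp only at h0 h1 h3 ⊢
  subst h0
  have hφ : φ = 0 := by
    refine Continuous.ae_eq_iff_eq (volume : Measure ℝ) h2.continuous continuous_const |>.1 ?_
    exact h1.symm.trans (Lp.coeFn_zero ℂ 2 (volume : Measure ℝ))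
  subst hφ
  have hd : deriv (0 : ℝ → ℂ) = 0 := by
    funext t; exact deriv_const t (0 : ℂ)
  have hloc : LocallyIntegrable (g : ℝ → ℂ) volume :=
    (Lp.memLp g).locallyIntegrable (by norm_num)
  have hz : ∀ a b : ℝ, ∫ t in a..b, g t = 0 := by
    intro a b
    have := (h3 a b).2
    rw [hd] at this
    simpa [intervalIntegral.integral_neg] using this
  have hg : (g : ℝ → ℂ) =ᵐ[volume] (0 : ℝ → ℂ) := by
    filter_upwards [LocallyIntegrable.ae_hasDerivAt_integral hloc] with x hx
    have h := hx 0
    simp only [hz] at h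
    exact h.unique (hasDerivAt_const x (0 : ℂ))
  exact Lp.ext (hg.trans (Lp.coeFn_zero ℂ 2 (volume : Measure ℝ)).symm)

/-- The maximal operator `L y = -y'' + q y` in `L²(ℝ)`. -/
noncomputable def schrodingerOp (q : ℝ → ℝ) : L2 →ₗ.[ℂ] L2 :=
  (schrodingerGraph q).toLinearPMap

/-! ### Solutions of the differential equation -/

/-- `y` solves `-y'' + q y = z y` on the interval `I`: it is differentiable on `I` (one-sidedly at an
end point that belongs to `I`), and `y'` is a primitive of `(q - z) y`. -/
def IsSolution (q : ℝ → ℝ) (z : ℂ) (I : Set ℝ) (y : ℝ → ℂ) : Prop :=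
  DifferentiableOn ℝ y I ∧
    ∀ a ∈ I, ∀ b ∈ I, derivWithin y I b - derivWithin y I a = ∫ t in a..b, ((q t : ℂ) - z) * y t

/-- `y` solves `-y'' + q y = z y` on `I`, lies in `L²(I)` and has norm one there. -/
structure IsNormalizedSolution (q : ℝ → ℝ) (z : ℂ) (I : Set ℝ) (y : ℝ → ℂ) : Prop where
  isSolution : IsSolution q z I y
  memLp : MemLp (I.indicator y) 2 (volume : Measure ℝ)
  norm_eq : ∫ x in I, ‖y x‖ ^ 2 = 1

/-- The element of `L²(ℝ)` that is equal to `y` on `I` and to zero off `I`. -/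
noncomputable def extendL2 (I : Set ℝ) (y : ℝ → ℂ) : L2 :=
  open Classical in
  if h : MemLp (I.indicator y) 2 (volume : Measure ℝ) then h.toLp _ else 0

/-- The subspace `L²(I)` of `L²(ℝ)`: the elements that vanish almost everywhere off `I`. -/
noncomputable def l2On (I : Set ℝ) : Submodule ℂ L2 where
  carrier := {f | ∀ᵐ x ∂(volume : Measure ℝ), x ∉ I → f x = 0}
  zero_mem' := by
    filter_upwards [Lp.coeFn_zero ℂ 2 (volume : Measure ℝ)] with x hx _
    rw [hx]; rfl
  add_mem' := by
    intro f g hf hg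
    filter_upwards [hf, hg, Lp.coeFn_add f g] with x h1 h2 h3 hx
    rw [h3, Pi.add_apply, h1 hx, h2 hx, add_zero]
  smul_mem' := by
    intro c f hf
    filter_upwards [hf, Lp.coeFn_smul c f] with x h1 h2 hx
    rw [h2, Pi.smul_apply, h1 hx, smul_zero]

/-- `y` is the solution on `ℝ` of `-y'' + q y = z y`, `y(0) = a`, `y'(0) = b`. -/
def IsCauchySolution (q : ℝ → ℝ) (z a b : ℂ) (y : ℝ → ℂ) : Prop :=
  IsSolution q z univ y ∧ y 0 = a ∧ deriv y 0 = b

/-- The solution on `ℝ` of `-y'' + q y = z y`, `y(0) = a`, `y'(0) = b`. -/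
noncomputable def cauchySolution (q : ℝ → ℝ) (z a b : ℂ) : ℝ → ℂ :=
  Classical.epsilon (IsCauchySolution q z a b)

/-- The standard fundamental matrix `𝔅_x(z) = [c s; c' s'](x)`, with `𝔅_0(z) = I`. -/
noncomputable def fundamentalMatrix (q : ℝ → ℝ) (z : ℂ) (x : ℝ) : Matrix (Fin 2) (Fin 2) ℂ :=
  !![cauchySolution q z 1 0 x, cauchySolution q z 0 1 x;
     deriv (cauchySolution q z 1 0) x, deriv (cauchySolution q z 0 1) x]

/-- The matrix `[e⁺(x₀, λ₀), -e⁺(x₀, -λ̄₀); ė⁺(x₀, λ₀), -ė⁺(x₀, -λ̄₀)]`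
(derivatives at the left end point of `[x₀, ∞)`). -/
noncomputable def plusMatrix (lam₀ : ℂ) (x₀ : ℝ) (ePlus : ℂ → ℝ → ℂ) :
    Matrix (Fin 2) (Fin 2) ℂ :=
  !![ePlus lam₀ x₀, -ePlus (-conj lam₀) x₀;
     derivWithin (ePlus lam₀) (Ici x₀) x₀, -derivWithin (ePlus (-conj lam₀)) (Ici x₀) x₀]

/-- The matrix `[-e⁻(0, -λ̄₀), e⁻(0, λ₀); -ė⁻(0, -λ̄₀), ė⁻(0, λ₀)]`
(derivatives at the right end point of `(-∞, 0]`). -/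
noncomputable def minusMatrix (lam₀ : ℂ) (eMinus : ℂ → ℝ → ℂ) : Matrix (Fin 2) (Fin 2) ℂ :=
  !![-eMinus (-conj lam₀) 0, eMinus lam₀ 0;
     -derivWithin (eMinus (-conj lam₀)) (Iic 0) 0, derivWithin (eMinus lam₀) (Iic 0) 0]

/-- The change of spectral variable `ζ = (λ² - λ₀²) / (λ² - λ̄₀²)`. -/
noncomputable def spectralVar (lam₀ lam : ℂ) : ℂ :=
  (lam ^ 2 - lam₀ ^ 2) / (lam ^ 2 - conj lam₀ ^ 2)

end SchrodingerNode

/-! Write `z = λ₀²`, `w = λ²`. For self-adjoint `L`, `u f = g` means that `y = (z - z̄)⁻¹ (g - f)`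
lies in the domain of `L` and `L y = f + z y` (`cayley_eq_iff`). Insert `f = (w - z) k + c₁ e⁻(-λ̄₀)
+ d₂ e⁺(-λ̄₀)` and `g = (w - z̄) k + d₁ e⁺(λ₀) + c₂ e⁻(λ₀)`. On `(0, x₀)` one gets `y = k`, and the
equation becomes `L k = w k`. On the two half-lines `y` is, up to the factor `(z - z̄)⁻¹`, `c₂
e⁻(λ₀) - c₁ e⁻(-λ̄₀)` and `d₁ e⁺(λ₀) - d₂ e⁺(-λ̄₀)`, for which the equation is automatic. The only
remaining condition is that `y` and `y'` be continuous at `0` and `x₀`, that is, that the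
fundamental matrix at `w` carry the Cauchy data of the left piece to those of the right piece. This
is `exists_cayley_eq_iff`, and all formulas follow from it by linear algebra.

Self-adjointness enters in three further places. It makes `u` unitary
(`exists_linearIsometryEquiv_cayley`). It forces the square integrable solutions on a half-line at a
nonreal point to form a line (`IsGlobalSolution.exists_eq_const_mul`), so that `u` maps `K ⊕ E₁`
into `K ⊕ E₂` (`cayley_mem_sup`); the same argument at `z̄` gives equality. It also makes the matrix
of the `e⁺` invertible (`IsTail.det_ne_zero`): equal Cauchy data at `x₀` of solutions at `z` and
`z̄` would produce a domain element violating symmetry.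

The node equations `U (ζ k + e) = k + Θ(ζ) e` become the relation above once `k` is rescaled, which
identifies the transfer matrix. As `q` is only locally integrable, existence and uniqueness for the
differential equation come from a Volterra equation in a weighted sup norm. -/

namespace SchrodingerNode

/-! ### Self-adjoint operators: resolvent at nonreal points and Cayley transform. -/

section SelfAdjoint

theorem sub_conj_ne_zero {z : ℂ} (hz : z.im ≠ 0) : z - conj z ≠ 0 := by
  intro h
  have := congrArg Complex.im h
  simp at this
  exact hz this

variable {H : Type*} [NormedAddCommGroup H] [InnerProductSpace ℂ H]

theorem symmetric_graph [CompleteSpace H] {A : H →ₗ.[ℂ] H} (hA : IsSelfAdjoint A) {p p' : H × H}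
    (hp : p ∈ A.graph) (hp' : p' ∈ A.graph) : inner ℂ p.2 p'.1 = inner ℂ p.1 p'.2 := by
  have h := LinearPMap.adjoint_graph_eq_graph_adjoint hA.dense_domain
  rw [LinearPMap.isSelfAdjoint_def.1 hA] at h
  rw [h] at hp'
  exact sub_eq_zero.1 ((Submodule.mem_adjoint_iff _ _).1 hp' p.1 p.2 hp)

theorem mem_graph_of_forall_inner_eq [CompleteSpace H] {A : H →ₗ.[ℂ] H} (hA : IsSelfAdjoint A)
    {p' : H × H} (h : ∀ p ∈ A.graph, inner ℂ p.2 p'.1 = inner ℂ p.1 p'.2) : p' ∈ A.graph := by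
  have h' := LinearPMap.adjoint_graph_eq_graph_adjoint hA.dense_domain
  rw [LinearPMap.isSelfAdjoint_def.1 hA] at h'
  rw [h']
  exact (Submodule.mem_adjoint_iff _ _).2 fun a b hab => sub_eq_zero.2 (h (a, b) hab)

/-- By symmetry `⟨A y, y⟩` is real, so the cross term in the expanded square sees only the real part
of `z`. This is the isometry of the Cayley transform. -/
theorem norm_sub_smul_conj [CompleteSpace H] {A : H →ₗ.[ℂ] H} (hA : IsSelfAdjoint A) (z : ℂ)
    {p : H × H} (hp : p ∈ A.graph) : ‖p.2 - z • p.1‖ = ‖p.2 - conj z • p.1‖ := by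
  have hs := symmetric_graph hA hp hp
  have hr : (inner ℂ p.2 p.1 : ℂ).im = 0 := by
    have := congrArg Complex.im (inner_conj_symm (𝕜 := ℂ) p.2 p.1)
    rw [← hs, Complex.conj_im] at this
    linarith
  have h : ‖p.2 - z • p.1‖ ^ 2 = ‖p.2 - conj z • p.1‖ ^ 2 := by
    rw [@norm_sub_sq ℂ, @norm_sub_sq ℂ, inner_smul_right, inner_smul_right, norm_smul, norm_smul]
    simp [hr]
  exact (sq_eq_sq₀ (norm_nonneg _) (norm_nonneg _)).1 h

/-- Since `⟨y, A y⟩` is real, the imaginary part of `⟨y, (A - z) y⟩` is `-Im z ‖y‖²`; Cauchy-Schwarz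
does the rest. -/
theorem abs_im_mul_norm_le [CompleteSpace H] {A : H →ₗ.[ℂ] H} (hA : IsSelfAdjoint A) (z : ℂ)
    {p : H × H} (hp : p ∈ A.graph) : |z.im| * ‖p.1‖ ≤ ‖p.2 - z • p.1‖ := by
  have hs := symmetric_graph hA hp hp
  have hr : (inner ℂ p.1 p.2 : ℂ).im = 0 := by
    have := congrArg Complex.im (inner_conj_symm (𝕜 := ℂ) p.2 p.1)
    rw [← hs, Complex.conj_im] at this
    rw [← hs]
    linarith
  have h1 : (inner ℂ p.1 (p.2 - z • p.1) : ℂ).im = - z.im * ‖p.1‖ ^ 2 := by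
    rw [inner_sub_right, inner_smul_right, inner_self_eq_norm_sq_to_K, Complex.sub_im, hr]
    simp [Complex.mul_im, ← Complex.ofReal_pow]
  have h2 : |z.im| * ‖p.1‖ ^ 2 ≤ ‖p.1‖ * ‖p.2 - z • p.1‖ := by
    calc |z.im| * ‖p.1‖ ^ 2 = |(inner ℂ p.1 (p.2 - z • p.1) : ℂ).im| := by
          rw [h1, abs_mul, abs_neg, abs_of_nonneg (sq_nonneg ‖p.1‖)]
      _ ≤ _ := (Complex.abs_im_le_norm _).trans (norm_inner_le_norm _ _)
  rcases (norm_nonneg p.1).eq_or_lt with h0 | h0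
  · rw [← h0]; simp
  · exact le_of_mul_le_mul_left (by linarith) h0

/-- The lower bound `abs_im_mul_norm_le` makes `A - z` bounded below on the closed graph, so its
range is closed. A vector orthogonal to the range lies in the kernel of `A - z̄`, which the same
bound at `z̄` shows to be zero. -/
theorem exists_mem_graph_sub_smul_eq [CompleteSpace H] {A : H →ₗ.[ℂ] H} (hA : IsSelfAdjoint A)
    {z : ℂ} (hz : z.im ≠ 0) (f : H) : ∃ p ∈ A.graph, p.2 - z • p.1 = f := by
  have hcl : IsClosed (A.graph : Set (H × H)) := hA.isClosed
  have : CompleteSpace A.graph := hcl.completeSpace_coe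
  let T : A.graph →L[ℂ] H :=
    (ContinuousLinearMap.snd ℂ H H - z • ContinuousLinearMap.fst ℂ H H).comp A.graph.subtypeL
  have hT : ∀ p : A.graph, T p = (p : H × H).2 - z • (p : H × H).1 := fun _ => rfl
  have hz' : 0 < |z.im| := abs_pos.2 hz
  have hbd : ∀ p : A.graph, ‖p‖ ≤ (|z.im|⁻¹ + (1 + ‖z‖ * |z.im|⁻¹)) * ‖T p‖ := by
    intro p
    have h1 : ‖(p : H × H).1‖ ≤ |z.im|⁻¹ * ‖T p‖ := by
      rw [← div_eq_inv_mul, le_div_iff₀ hz', mul_comm]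
      exact abs_im_mul_norm_le hA z p.2
    have h2 : ‖(p : H × H).2‖ ≤ (1 + ‖z‖ * |z.im|⁻¹) * ‖T p‖ := by
      calc ‖(p : H × H).2‖ = ‖T p + z • (p : H × H).1‖ := by rw [hT]; simp
        _ ≤ ‖T p‖ + ‖z‖ * ‖(p : H × H).1‖ := (norm_add_le _ _).trans (by rw [norm_smul])
        _ ≤ ‖T p‖ + ‖z‖ * (|z.im|⁻¹ * ‖T p‖) := by gcongr
        _ = _ := by ring
    have h3 : 0 ≤ |z.im|⁻¹ * ‖T p‖ := by positivity
    have h4 : 0 ≤ (1 + ‖z‖ * |z.im|⁻¹) * ‖T p‖ := by positivity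
    rw [Submodule.coe_norm, Prod.norm_def, add_mul]
    exact max_le (by linarith) (by linarith)
  have hanti : AntilipschitzWith (Real.toNNReal (|z.im|⁻¹ + (1 + ‖z‖ * |z.im|⁻¹))) T := by
    refine AddMonoidHomClass.antilipschitz_of_bound T fun p => ?_
    rw [Real.coe_toNNReal _ (by positivity)]
    exact hbd p
  have hrange : IsClosed (LinearMap.range (T : A.graph →ₗ[ℂ] H) : Set H) := by
    have := hanti.isClosed_range T.uniformContinuous
    rw [LinearMap.coe_range]
    exact this
  have : CompleteSpace (LinearMap.range (T : A.graph →ₗ[ℂ] H)) := hrange.completeSpace_coe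
  have horth : (LinearMap.range (T : A.graph →ₗ[ℂ] H))ᗮ = ⊥ := by
    rw [Submodule.eq_bot_iff]
    intro w hw
    have hw' : ∀ p ∈ A.graph, inner ℂ (p.2 - z • p.1) w = 0 := fun p hp =>
      (Submodule.mem_orthogonal _ _).1 hw _ ⟨⟨p, hp⟩, rfl⟩
    have hmem : (w, conj z • w) ∈ A.graph := by
      refine mem_graph_of_forall_inner_eq hA fun p hp => ?_
      have := hw' p hp
      rw [inner_sub_left, inner_smul_left, sub_eq_zero] at this
      rw [this, inner_smul_right]
    have := abs_im_mul_norm_le hA (conj z) hmem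
    simp only [sub_self, norm_zero, Complex.conj_im, abs_neg] at this
    exact norm_eq_zero.1 (le_antisymm (nonpos_of_mul_nonpos_right this hz') (norm_nonneg _))
  have htop := Submodule.orthogonal_eq_bot_iff.1 horth
  obtain ⟨p, hp⟩ := htop ▸ (Submodule.mem_top : f ∈ (⊤ : Submodule ℂ H))
  exact ⟨p, p.2, hp⟩

theorem eq_of_sub_smul_eq [CompleteSpace H] {A : H →ₗ.[ℂ] H} (hA : IsSelfAdjoint A)
    {z : ℂ} (hz : z.im ≠ 0) {p p' : H × H} (hp : p ∈ A.graph) (hp' : p' ∈ A.graph)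
    (h : p.2 - z • p.1 = p'.2 - z • p'.1) : p.1 = p'.1 := by
  have h1 := abs_im_mul_norm_le hA z (A.graph.sub_mem hp hp')
  have h2 : (p - p').2 - z • (p - p').1 = 0 := by
    rw [Prod.snd_sub, Prod.fst_sub, smul_sub, sub_sub_sub_comm, h, sub_self]
  rw [h2, norm_zero] at h1
  exact sub_eq_zero.1 (norm_eq_zero.1
    (le_antisymm (nonpos_of_mul_nonpos_right h1 (abs_pos.2 hz)) (norm_nonneg _)))

theorem existsUnique_sub_smul_eq [CompleteSpace H] {A : H →ₗ.[ℂ] H} (hA : IsSelfAdjoint A)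
    {z : ℂ} (hz : z.im ≠ 0) (f : H) : ∃! y : A.domain, A y - z • (y : H) = f := by
  obtain ⟨p, hp, hpf⟩ := exists_mem_graph_sub_smul_eq hA hz f
  obtain ⟨y, hy1, hy2⟩ := (LinearPMap.mem_graph_iff A).1 hp
  refine ⟨y, by simp only [hy1, hy2, hpf], fun y' hy' => ?_⟩
  refine Subtype.ext ?_
  refine eq_of_sub_smul_eq hA hz (A.mem_graph y') (A.mem_graph y) ?_
  simp only [hy', hy1, hy2, hpf]

/-- Uniqueness of the solution removes the choice in `resolventOp`; from here on the resolvent is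
used only through membership in the graph. -/
theorem resolventOp_eq_iff [CompleteSpace H] {A : H →ₗ.[ℂ] H} (hA : IsSelfAdjoint A)
    {z : ℂ} (hz : z.im ≠ 0) (f y : H) :
    resolventOp A z f = y ↔ (y, f + z • y) ∈ A.graph := by
  have hex := (existsUnique_sub_smul_eq hA hz f).exists
  have hR : resolventOp A z f = hex.choose := by
    unfold resolventOp; rw [dif_pos hex]
  have hc := hex.choose_spec
  constructor
  · rintro rfl
    rw [hR, ← sub_eq_iff_eq_add.1 hc]
    exact A.mem_graph _
  · intro h
    rw [hR]
    refine eq_of_sub_smul_eq hA hz (A.mem_graph hex.choose) h ?_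
    simp only [hc, add_sub_cancel_right]

/-- The Cayley transform maps `(A - z) y` to `(A - z̄) y`. -/
theorem cayley_eq_iff [CompleteSpace H] {A : H →ₗ.[ℂ] H} (hA : IsSelfAdjoint A)
    {z : ℂ} (hz : z.im ≠ 0) (f g : H) :
    cayley A z f = g ↔
      ((z - conj z)⁻¹ • (g - f), f + z • (z - conj z)⁻¹ • (g - f)) ∈ A.graph := by
  have hδ := sub_conj_ne_zero hz
  rw [← resolventOp_eq_iff hA hz]
  unfold cayley
  constructor
  · rintro rfl
    rw [add_sub_cancel_left, smul_smul, inv_mul_cancel₀ hδ, one_smul]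
  · intro h
    rw [h, smul_smul, mul_inv_cancel₀ hδ, one_smul, add_sub_cancel]

theorem exists_linearIsometryEquiv_cayley [CompleteSpace H] {A : H →ₗ.[ℂ] H}
    (hA : IsSelfAdjoint A) {z : ℂ} (hz : z.im ≠ 0) :
    ∃ u : H ≃ₗᵢ[ℂ] H, ∀ f, u f = cayley A z f := by
  have hδ := sub_conj_ne_zero hz
  have hR := fun f => (resolventOp_eq_iff hA hz f _).1 rfl
  let u₀ : H →ₗ[ℂ] H :=
    { toFun := cayley A z
      map_add' := fun f g => by
        have : resolventOp A z (f + g) = resolventOp A z f + resolventOp A z g := by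
          rw [resolventOp_eq_iff hA hz]
          convert A.graph.add_mem (hR f) (hR g) using 1
          ext <;> simp
          abel
        simp only [cayley, this, smul_add]
        abel
      map_smul' := fun c f => by
        have : resolventOp A z (c • f) = c • resolventOp A z f := by
          rw [resolventOp_eq_iff hA hz]
          convert A.graph.smul_mem c (hR f) using 1
          ext <;> simp [smul_comm c z]
        simp only [cayley, this, smul_add, RingHom.id_apply, smul_comm c (z - conj z)] }
  -- With `y` the resolvent applied to `f`, one has `f = (A - z) y` and `u₀ f = (A - z̄) y`.
  have hnorm : ∀ f, ‖u₀ f‖ = ‖f‖ := by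
    intro f
    have h := norm_sub_smul_conj hA z (hR f)
    simp only [add_sub_cancel_right] at h
    rw [h]
    change ‖f + (z - conj z) • resolventOp A z f‖ = _
    rw [sub_smul, add_sub_assoc]
  refine ⟨LinearIsometryEquiv.ofSurjective ⟨u₀, hnorm⟩ fun g => ?_, fun f => rfl⟩
  obtain ⟨p, hp, hpg⟩ := exists_mem_graph_sub_smul_eq hA (z := conj z) (by simpa using hz) g
  refine ⟨p.2 - z • p.1, ?_⟩
  change cayley A z _ = g
  have : resolventOp A z (p.2 - z • p.1) = p.1 := by
    rw [resolventOp_eq_iff hA hz]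
    simpa using hp
  rw [cayley, this, ← hpg, sub_smul]
  abel

end SelfAdjoint

/-! ### Volterra equations with locally integrable kernel. -/

section Volterra

/-- The weight `exp (2 |∫_p^t w|)`, for which a linear Volterra operator with kernel bounded by `w`
has norm at most one half. -/
noncomputable def bieleckiWeight (w : ℝ → ℝ) (p t : ℝ) : ℝ := Real.exp (2 * |∫ s in p..t, w s|)

variable {w : ℝ → ℝ}

theorem one_le_bieleckiWeight (w : ℝ → ℝ) (p t : ℝ) : 1 ≤ bieleckiWeight w p t :=
  Real.one_le_exp (by positivity)

theorem bieleckiWeight_pos (w : ℝ → ℝ) (p t : ℝ) : 0 < bieleckiWeight w p t := Real.exp_pos _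

theorem _root_.MeasureTheory.LocallyIntegrable.intervalIntegrable' {E : Type*}
    [NormedAddCommGroup E] {f : ℝ → E} (hf : LocallyIntegrable f volume) (a b : ℝ) :
    IntervalIntegrable f volume a b :=
  (hf.integrableOn_isCompact isCompact_uIcc).intervalIntegrable

theorem continuous_bieleckiWeight (hw : LocallyIntegrable w volume) (p : ℝ) :
    Continuous (bieleckiWeight w p) := by
  have := intervalIntegral.continuous_primitive hw.intervalIntegrable' p
  unfold bieleckiWeight
  fun_prop

/-- The integrand is almost everywhere half the derivative of the monotone function `σ exp (2 σ ∫
w)`, and the integral of the derivative of a monotone function does not exceed its increment. The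
sign `σ = ±1` accommodates both directions of integration. -/
theorem abs_integral_mul_exp_le (hw : LocallyIntegrable w volume) (hw0 : ∀ t, 0 ≤ w t)
    {σ : ℝ} (hσ : σ * σ = 1) (p t : ℝ) :
    |∫ s in p..t, w s * Real.exp (2 * (σ * ∫ r in p..s, w r))| ≤
      |Real.exp (2 * (σ * ∫ r in p..t, w r)) - 1| / 2 := by
  set f : ℝ → ℝ := fun s => σ * Real.exp (2 * (σ * ∫ r in p..s, w r)) with hf
  have hprim : Monotone fun s => ∫ r in p..s, w r := by
    intro a b hab
    have h1 := intervalIntegral.integral_add_adjacent_intervals (hw.intervalIntegrable' p a)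
      (hw.intervalIntegrable' a b)
    have h2 := intervalIntegral.integral_nonneg (μ := volume) hab fun u _ => hw0 u
    simp only
    linarith
  have hσ' : σ = 1 ∨ σ = -1 := mul_self_eq_one_iff.1 hσ
  have hmono : Monotone f := by
    intro a b hab
    have := hprim hab
    rcases hσ' with rfl | rfl
    · simp only [hf, one_mul]
      gcongr
    · simp only [hf, neg_mul, one_mul]
      rw [neg_le_neg_iff, Real.exp_le_exp]
      simp only at this
      linarith
  have hderiv : ∀ᵐ s, deriv f s = 2 * (w s * Real.exp (2 * (σ * ∫ r in p..s, w r))) := by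
    filter_upwards [LocallyIntegrable.ae_hasDerivAt_integral hw] with s hs
    have := ((((hs p).const_mul σ).const_mul 2).exp.const_mul σ).deriv
    rw [this]
    linear_combination 2 * w s * Real.exp (2 * (σ * ∫ r in p..s, w r)) * hσ
  have h := (hmono.monotoneOn (uIcc p t)).intervalIntegral_deriv_mem_uIcc
  rw [intervalIntegral.integral_congr_ae (hderiv.mono fun _ hs _ => hs),
    intervalIntegral.integral_const_mul] at h
  have h' := abs_sub_left_of_mem_uIcc h
  rw [sub_zero, sub_zero, abs_mul, abs_two] at h'
  have hfp : f t - f p = σ * (Real.exp (2 * (σ * ∫ r in p..t, w r)) - 1) := by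
    simp only [hf, intervalIntegral.integral_same, mul_zero, Real.exp_zero]
    ring
  have hσabs : |σ| = 1 := by rcases hσ' with rfl | rfl <;> simp
  rw [hfp, abs_mul, hσabs, one_mul] at h'
  linarith

theorem abs_integral_mul_bieleckiWeight_le (hw : LocallyIntegrable w volume)
    (hw0 : ∀ t, 0 ≤ w t) (p t : ℝ) :
    |∫ s in p..t, w s * bieleckiWeight w p s| ≤ bieleckiWeight w p t / 2 := by
  obtain ⟨σ, hσ, hσt⟩ : ∃ σ : ℝ, σ * σ = 1 ∧
      ∀ s ∈ uIcc p t, |∫ r in p..s, w r| = σ * ∫ r in p..s, w r := by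
    rcases le_total p t with h | h
    · refine ⟨1, by norm_num, fun s hs => ?_⟩
      rw [uIcc_of_le h] at hs
      rw [one_mul, abs_of_nonneg (intervalIntegral.integral_nonneg hs.1 fun u _ => hw0 u)]
    · refine ⟨-1, by norm_num, fun s hs => ?_⟩
      rw [uIcc_of_ge h] at hs
      rw [neg_one_mul, abs_of_nonpos]
      rw [intervalIntegral.integral_symm, neg_nonpos]
      exact intervalIntegral.integral_nonneg hs.2 fun u _ => hw0 u
  have h := abs_integral_mul_exp_le hw hw0 hσ p t
  have e1 : ∫ s in p..t, w s * bieleckiWeight w p s =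
      ∫ s in p..t, w s * Real.exp (2 * (σ * ∫ r in p..s, w r)) := by
    refine intervalIntegral.integral_congr fun s hs => ?_
    simp only [bieleckiWeight, hσt s hs]
  have e2 : bieleckiWeight w p t = Real.exp (2 * (σ * ∫ r in p..t, w r)) := by
    rw [bieleckiWeight, hσt t right_mem_uIcc]
  have h1 := one_le_bieleckiWeight w p t
  rw [← e1, ← e2, abs_of_nonneg (sub_nonneg.2 h1)] at h
  linarith

/-- The gain of the factor one half over the weighted sup norm; both the uniqueness and the
existence argument rest on it. -/
theorem norm_integral_le_bieleckiWeight {E : Type*} [NormedAddCommGroup E] [NormedSpace ℝ E]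
    (hw : LocallyIntegrable w volume) (hw0 : ∀ t, 0 ≤ w t) {p t C : ℝ} {f : ℝ → E} (hC : 0 ≤ C)
    (hf : ∀ s ∈ uIcc p t, ‖f s‖ ≤ w s * (C * bieleckiWeight w p s)) :
    ‖∫ s in p..t, f s‖ ≤ C * bieleckiWeight w p t / 2 := by
  have hint : IntervalIntegrable (fun s => w s * (C * bieleckiWeight w p s)) volume p t :=
    (hw.intervalIntegrable' p t).mul_continuousOn
      ((continuous_bieleckiWeight hw p).const_mul C).continuousOn
  refine (intervalIntegral.norm_integral_le_abs_of_norm_le (g := fun s =>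
    w s * (C * bieleckiWeight w p s)) ?_ hint).trans ?_
  · filter_upwards [ae_restrict_mem measurableSet_uIoc] with s hs
    exact hf s (uIoc_subset_uIcc hs)
  · simp only [mul_left_comm _ C, intervalIntegral.integral_const_mul]
    rw [abs_mul, abs_of_nonneg hC, mul_div_assoc]
    exact mul_le_mul_of_nonneg_left (abs_integral_mul_bieleckiWeight_le hw hw0 p t) hC

/-- A Gronwall lemma with locally integrable kernel. -/
theorem eq_zero_of_norm_eq_integral {E : Type*} [NormedAddCommGroup E] [NormedSpace ℝ E]
    (hw : LocallyIntegrable w volume) (hw0 : ∀ t, 0 ≤ w t) {p t : ℝ} {Y f : ℝ → E}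
    (hY : ContinuousOn Y (uIcc p t)) (hf : ∀ s ∈ uIcc p t, ‖f s‖ ≤ w s * ‖Y s‖)
    (h : ∀ s ∈ uIcc p t, Y s = ∫ r in p..s, f r) : Y t = 0 := by
  have hcont : ContinuousOn (fun s => ‖Y s‖ / bieleckiWeight w p s) (uIcc p t) :=
    hY.norm.div (continuous_bieleckiWeight hw p).continuousOn
      fun s _ => (bieleckiWeight_pos w p s).ne'
  -- At a point where `‖Y‖` divided by the weight is maximal, the integral equation bounds this
  -- maximum by half of itself.
  obtain ⟨s, hs, hmax⟩ := isCompact_uIcc.exists_isMaxOn nonempty_uIcc hcont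
  set D := ‖Y s‖ / bieleckiWeight w p s with hD
  have hD0 : 0 ≤ D := div_nonneg (norm_nonneg _) (bieleckiWeight_pos w p s).le
  have hle : ∀ r ∈ uIcc p t, ‖Y r‖ ≤ D * bieleckiWeight w p r := fun r hr =>
    (div_le_iff₀ (bieleckiWeight_pos w p r)).1 (hmax hr)
  have h1 : ‖Y s‖ ≤ D * bieleckiWeight w p s / 2 := by
    rw [h s hs]
    refine norm_integral_le_bieleckiWeight hw hw0 hD0 fun r hr => ?_
    have hr' : r ∈ uIcc p t := uIcc_subset_uIcc left_mem_uIcc hs hr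
    exact (hf r hr').trans (mul_le_mul_of_nonneg_left (hle r hr') (hw0 r))
  have h2 : ‖Y s‖ = D * bieleckiWeight w p s := by
    rw [hD, div_mul_cancel₀ _ (bieleckiWeight_pos w p s).ne']
  have h3 : D = 0 := by
    have h4 := bieleckiWeight_pos w p s
    by_contra hne
    have := mul_pos (lt_of_le_of_ne hD0 (Ne.symm hne)) h4
    linarith
  have := hle t right_mem_uIcc
  rw [h3, zero_mul] at this
  exact norm_le_zero_iff.1 this

/-- Global solvability of a Lipschitz Volterra equation with locally integrable Lipschitz constant
(Carathéodory). -/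
theorem exists_eq_add_integral {E : Type*} [NormedAddCommGroup E] [NormedSpace ℝ E]
    [CompleteSpace E] (hw : LocallyIntegrable w volume) (hw0 : ∀ t, 0 ≤ w t) {A : ℝ → E → E}
    (hA : ∀ s Y Y', ‖A s Y - A s Y'‖ ≤ w s * ‖Y - Y'‖) (hA0 : ∀ s, A s 0 = 0)
    (hAi : ∀ Y : ℝ → E, Continuous Y → ∀ a b, IntervalIntegrable (fun s => A s (Y s)) volume a b)
    (p : ℝ) (Y₀ : E) :
    ∃ Y : ℝ → E, Continuous Y ∧ ∀ t, Y t = Y₀ + ∫ s in p..t, A s (Y s) := by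
  -- The unknown is `Z = Y / W`, sought among bounded continuous functions on the whole line. After
  -- division by the weight the Picard map is a contraction with constant one half, so no
  -- continuation of local solutions is needed.
  set W := bieleckiWeight w p with hW
  have hWc : Continuous W := continuous_bieleckiWeight hw p
  have hWp : ∀ t, 0 < W t := bieleckiWeight_pos w p
  have hint : ∀ Z : BoundedContinuousFunction ℝ E, ∀ a b,
      IntervalIntegrable (fun s => A s (W s • Z s)) volume a b := fun Z =>
    hAi _ (hWc.smul Z.continuous)
  have hcont : ∀ Z : BoundedContinuousFunction ℝ E, Continuous fun t =>
      (W t)⁻¹ • (Y₀ + ∫ s in p..t, A s (W s • Z s)) := fun Z =>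
    (hWc.inv₀ fun t => (hWp t).ne').smul (continuous_const.add
      (intervalIntegral.continuous_primitive (hint Z) p))
  have hbd : ∀ Z Z' : BoundedContinuousFunction ℝ E, ∀ t,
      ‖(∫ s in p..t, A s (W s • Z s)) - ∫ s in p..t, A s (W s • Z' s)‖ ≤
        dist Z Z' * W t / 2 := by
    intro Z Z' t
    rw [← intervalIntegral.integral_sub (hint Z p t)
      (hint Z' p t)]
    refine norm_integral_le_bieleckiWeight hw hw0 dist_nonneg fun s _ => (hA s _ _).trans ?_
    refine mul_le_mul_of_nonneg_left ?_ (hw0 s)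
    rw [← smul_sub, norm_smul, Real.norm_of_nonneg (hWp s).le, mul_comm, ← dist_eq_norm]
    exact mul_le_mul_of_nonneg_right (BoundedContinuousFunction.dist_coe_le_dist s) (hWp s).le
  have hbd0 : ∀ Z : BoundedContinuousFunction ℝ E, ∀ t,
      ‖(W t)⁻¹ • (Y₀ + ∫ s in p..t, A s (W s • Z s))‖ ≤ ‖Y₀‖ + dist Z 0 / 2 := by
    intro Z t
    have h := hbd Z 0 t
    simp only [BoundedContinuousFunction.coe_zero, Pi.zero_apply, smul_zero, hA0,
      intervalIntegral.integral_zero, sub_zero] at h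
    have h1 : 1 ≤ W t := one_le_bieleckiWeight w p t
    rw [norm_smul, norm_inv, Real.norm_of_nonneg (hWp t).le, inv_mul_le_iff₀ (hWp t)]
    calc _ ≤ ‖Y₀‖ + dist Z 0 * W t / 2 := (norm_add_le _ _).trans (by gcongr)
      _ ≤ W t * ‖Y₀‖ + dist Z 0 * W t / 2 := by
        gcongr
        exact le_mul_of_one_le_left (norm_nonneg _) h1
      _ = _ := by ring
  let T : BoundedContinuousFunction ℝ E → BoundedContinuousFunction ℝ E := fun Z =>
    BoundedContinuousFunction.ofNormedAddCommGroup _ (hcont Z) _ (hbd0 Z)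
  have hT : ContractingWith (1 / 2 : NNReal) T := by
    refine ⟨by rw [← NNReal.coe_lt_coe]; norm_num, LipschitzWith.of_dist_le_mul fun Z Z' => ?_⟩
    rw [BoundedContinuousFunction.dist_le (by positivity)]
    intro t
    rw [dist_eq_norm]
    change ‖(W t)⁻¹ • (Y₀ + ∫ s in p..t, A s (W s • Z s)) -
      (W t)⁻¹ • (Y₀ + ∫ s in p..t, A s (W s • Z' s))‖ ≤ _
    rw [← smul_sub, add_sub_add_left_eq_sub, norm_smul, norm_inv,
      Real.norm_of_nonneg (hWp t).le, inv_mul_le_iff₀ (hWp t)]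
    refine (hbd Z Z' t).trans (le_of_eq ?_)
    push_cast
    ring
  set Z := ContractingWith.fixedPoint T hT
  have hZ : ∀ t, (W t)⁻¹ • (Y₀ + ∫ s in p..t, A s (W s • Z s)) = Z t := fun t =>
    DFunLike.congr_fun (ContractingWith.fixedPoint_isFixedPt hT) t
  refine ⟨fun t => W t • Z t, hWc.smul Z.continuous, fun t => ?_⟩
  simp only
  rw [← hZ t, smul_smul, mul_inv_cancel₀ (hWp t).ne', one_smul]

end Volterra

/-! ### Existence, uniqueness, gluing and propagation of Cauchy data for the differential equation.
-/

section ODE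

/-- `φ` is a solution on the line of `-φ'' + q φ = g`, with derivative `v`. -/
structure IsForcedSolution (q : ℝ → ℝ) (g φ v : ℝ → ℂ) : Prop where
  hasDerivAt : ∀ x, HasDerivAt φ (v x) x
  intervalIntegrable : ∀ a b, IntervalIntegrable (fun t => (q t : ℂ) * φ t - g t) volume a b
  sub_eq : ∀ a b, v b - v a = ∫ t in a..b, ((q t : ℂ) * φ t - g t)

variable {q : ℝ → ℝ}

theorem locallyIntegrable_sub_const (hq : LocallyIntegrable q volume) (z : ℂ) :
    LocallyIntegrable (fun t => (q t : ℂ) - z) volume := by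
  have h1 : LocallyIntegrable (fun t => (q t : ℂ)) volume := fun x => by
    obtain ⟨s, hs, h⟩ := hq x
    exact ⟨s, hs, h.ofReal⟩
  exact h1.sub (continuous_const.locallyIntegrable)

theorem intervalIntegrable_sub_const_mul (hq : LocallyIntegrable q volume) (z : ℂ) {φ : ℝ → ℂ}
    {a b : ℝ} (hφ : ContinuousOn φ (uIcc a b)) :
    IntervalIntegrable (fun t => ((q t : ℂ) - z) * φ t) volume a b :=
  ((locallyIntegrable_sub_const hq z).intervalIntegrable' a b).mul_continuousOn hφ

namespace IsForcedSolution

variable {g g' φ φ' v v' : ℝ → ℂ}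

theorem continuous (h : IsForcedSolution q g φ v) : Continuous φ :=
  continuous_iff_continuousAt.2 fun x => (h.hasDerivAt x).continuousAt

theorem continuous_deriv (h : IsForcedSolution q g φ v) : Continuous v := by
  have : v = fun x => v 0 + ∫ t in (0 : ℝ)..x, ((q t : ℂ) * φ t - g t) := by
    funext x
    rw [← h.sub_eq]
    ring
  rw [this]
  exact continuous_const.add (intervalIntegral.continuous_primitive h.intervalIntegrable 0)

theorem deriv_eq (h : IsForcedSolution q g φ v) : deriv φ = v :=
  funext fun x => (h.hasDerivAt x).deriv

theorem congr_ae (h : IsForcedSolution q g φ v) (hg : g =ᵐ[volume] g') :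
    IsForcedSolution q g' φ v := by
  have hae : (fun t => (q t : ℂ) * φ t - g t) =ᵐ[volume] fun t => (q t : ℂ) * φ t - g' t := by
    filter_upwards [hg] with t ht
    rw [ht]
  refine ⟨h.hasDerivAt, fun a b => (h.intervalIntegrable a b).congr_ae (ae_restrict_of_ae hae),
    fun a b => ?_⟩
  rw [h.sub_eq, intervalIntegral.integral_congr_ae (hae.mono fun _ ht _ => ht)]

theorem add (h : IsForcedSolution q g φ v) (h' : IsForcedSolution q g' φ' v') :
    IsForcedSolution q (fun t => g t + g' t) (fun t => φ t + φ' t) (fun t => v t + v' t) := by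
  have e : (fun t => (q t : ℂ) * (φ t + φ' t) - (g t + g' t)) =
      fun t => ((q t : ℂ) * φ t - g t) + ((q t : ℂ) * φ' t - g' t) := by
    funext t; ring
  refine ⟨fun x => (h.hasDerivAt x).add (h'.hasDerivAt x), fun a b => ?_, fun a b => ?_⟩
  · rw [e]
    exact (h.intervalIntegrable a b).add (h'.intervalIntegrable a b)
  · rw [e, intervalIntegral.integral_add (h.intervalIntegrable a b) (h'.intervalIntegrable a b),
      ← h.sub_eq, ← h'.sub_eq]
    ring

theorem const_mul (h : IsForcedSolution q g φ v) (c : ℂ) :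
    IsForcedSolution q (fun t => c * g t) (fun t => c * φ t) (fun t => c * v t) := by
  have e : (fun t => (q t : ℂ) * (c * φ t) - c * g t) =
      fun t => c * ((q t : ℂ) * φ t - g t) := by
    funext t; ring
  refine ⟨fun x => (h.hasDerivAt x).const_mul c, fun a b => ?_, fun a b => ?_⟩
  · rw [e]
    exact (h.intervalIntegrable a b).const_mul c
  · rw [e, intervalIntegral.integral_const_mul, ← h.sub_eq]
    ring

theorem zero : IsForcedSolution q (fun _ => 0) (fun _ => 0) (fun _ => 0) :=
  ⟨fun x => hasDerivAt_const x 0, fun a b => by simp, fun a b => by simp⟩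

/-- Solutions with the same Cauchy data at a point can be glued there. -/
theorem glue (h : IsForcedSolution q g φ v) (h' : IsForcedSolution q g' φ' v') {p : ℝ}
    (hφ : φ p = φ' p) (hv : v p = v' p) :
    IsForcedSolution q (fun t => if t ≤ p then g t else g' t)
      (fun t => if t ≤ p then φ t else φ' t) (fun t => if t ≤ p then v t else v' t) := by
  have hle : ∀ b ≤ p, EqOn (fun t => (q t : ℂ) * φ t - g t) (fun t => (q t : ℂ) *
      (if t ≤ p then φ t else φ' t) - (if t ≤ p then g t else g' t)) (uIoc p b) := by
    intro b hb t ht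
    rw [uIoc_of_ge hb] at ht
    simp only [if_pos ht.2]
  have hge : ∀ b, p ≤ b → EqOn (fun t => (q t : ℂ) * φ' t - g' t) (fun t => (q t : ℂ) *
      (if t ≤ p then φ t else φ' t) - (if t ≤ p then g t else g' t)) (uIoc p b) := by
    intro b hb t ht
    rw [uIoc_of_le hb] at ht
    simp only [if_neg (not_le.2 ht.1)]
  have hint : ∀ b, IntervalIntegrable (fun t => (q t : ℂ) *
      (if t ≤ p then φ t else φ' t) - (if t ≤ p then g t else g' t)) volume p b := by
    intro b
    rcases le_total b p with hb | hb
    · exact (h.intervalIntegrable p b).congr (hle b hb)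
    · exact (h'.intervalIntegrable p b).congr (hge b hb)
  have hsub : ∀ b, (if b ≤ p then v b else v' b) - v p = ∫ t in p..b, ((q t : ℂ) *
      (if t ≤ p then φ t else φ' t) - (if t ≤ p then g t else g' t)) := by
    intro b
    rcases le_total b p with hb | hb
    · rw [if_pos hb, h.sub_eq]
      exact intervalIntegral.integral_congr_ae (Filter.Eventually.of_forall (hle b hb))
    · have : (if b ≤ p then v b else v' b) = v' b := by
        split_ifs with hbp
        · rw [le_antisymm hbp hb, hv]
        · rfl
      rw [this, hv, h'.sub_eq]
      exact intervalIntegral.integral_congr_ae (Filter.Eventually.of_forall (hge b hb))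
  refine ⟨fun x => ?_, fun a b => (hint a).symm.trans (hint b), fun a b => ?_⟩
  · rcases lt_trichotomy x p with hx | rfl | hx
    · simp only [if_pos hx.le]
      refine (h.hasDerivAt x).congr_of_eventuallyEq ?_
      filter_upwards [Iio_mem_nhds hx] with t ht
      rw [if_pos (le_of_lt ht)]
    · simp only [le_refl, if_true]
      rw [← hasDerivWithinAt_univ, ← Iic_union_Ici (a := x)]
      refine HasDerivWithinAt.union ?_ ?_
      · refine (h.hasDerivAt x).hasDerivWithinAt.congr (fun t ht => if_pos ht) (if_pos le_rfl)
      · rw [hv]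
        refine (h'.hasDerivAt x).hasDerivWithinAt.congr (fun t ht => ?_) ?_
        · split_ifs with htx
          · rw [le_antisymm htx ht, hφ]
          · rfl
        · rw [if_pos le_rfl, hφ]
    · simp only [if_neg (not_le.2 hx)]
      refine (h'.hasDerivAt x).congr_of_eventuallyEq ?_
      filter_upwards [Ioi_mem_nhds hx] with t ht
      rw [if_neg (not_le.2 ht)]
  · rw [← intervalIntegral.integral_add_adjacent_intervals (hint a).symm (hint b),
      intervalIntegral.integral_symm, ← hsub, ← hsub]
    ring

end IsForcedSolution

/-- On the interval between `p` and `x`, the pair `(φ, v)` satisfies the integral equation that is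
equivalent to `-φ'' + q φ = z φ`, `v = φ'`. -/
structure SolvesBetween (q : ℝ → ℝ) (z : ℂ) (p x : ℝ) (φ v : ℝ → ℂ) : Prop where
  continuousOn : ContinuousOn φ (uIcc p x)
  continuousOn_deriv : ContinuousOn v (uIcc p x)
  eq_add : ∀ s ∈ uIcc p x, φ s = φ p + ∫ t in p..s, v t
  deriv_eq_add : ∀ s ∈ uIcc p x, v s = v p + ∫ t in p..s, ((q t : ℂ) - z) * φ t

theorem norm_companion_le (z : ℂ) (t : ℝ) (Y : ℂ × ℂ) :
    ‖(Y.2, ((q t : ℂ) - z) * Y.1)‖ ≤ (1 + (|q t| + ‖z‖)) * ‖Y‖ := by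
  have h1 : ‖Y.1‖ ≤ ‖Y‖ := norm_fst_le Y
  have h2 : ‖Y.2‖ ≤ ‖Y‖ := norm_snd_le Y
  have h3 : ‖(q t : ℂ) - z‖ ≤ |q t| + ‖z‖ := by
    refine (norm_sub_le _ _).trans ?_
    rw [Complex.norm_real, Real.norm_eq_abs]
  have h4 : 0 ≤ |q t| + ‖z‖ := by positivity
  rw [Prod.norm_def]
  refine max_le ?_ ?_
  · calc ‖Y.2‖ ≤ 1 * ‖Y‖ := by rw [one_mul]; exact h2
      _ ≤ _ := mul_le_mul_of_nonneg_right (by linarith) (norm_nonneg _)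
  · calc ‖((q t : ℂ) - z) * Y.1‖ ≤ (|q t| + ‖z‖) * ‖Y‖ := by rw [norm_mul]; gcongr
      _ ≤ _ := mul_le_mul_of_nonneg_right (by linarith) (norm_nonneg _)

theorem locallyIntegrable_companion_bound (hq : LocallyIntegrable q volume) (z : ℂ) :
    LocallyIntegrable (fun t => 1 + (|q t| + ‖z‖)) volume := by
  have h1 : LocallyIntegrable (fun t => |q t|) volume := fun x => by
    obtain ⟨s, hs, h⟩ := hq x
    exact ⟨s, hs, h.abs⟩
  exact (continuous_const.locallyIntegrable).add (h1.add continuous_const.locallyIntegrable)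

theorem integral_prodMk {p s : ℝ} {f g : ℝ → ℂ} (hf : IntervalIntegrable f volume p s)
    (hg : IntervalIntegrable g volume p s) :
    ∫ t in p..s, (f t, g t) = (∫ t in p..s, f t, ∫ t in p..s, g t) := by
  have h : IntervalIntegrable (fun t => (f t, g t)) volume p s := by
    rw [intervalIntegrable_iff] at hf hg ⊢
    exact Integrable.prodMk hf hg
  have e1 := (ContinuousLinearMap.fst ℝ ℂ ℂ).intervalIntegral_comp_comm h
  have e2 := (ContinuousLinearMap.snd ℝ ℂ ℂ).intervalIntegral_comp_comm h
  exact Prod.ext e1.symm e2.symm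

/-- The difference of the two pairs has zero data at `p` and satisfies the homogeneous first-order
system in integral form, so the Gronwall lemma annihilates it. -/
theorem SolvesBetween.eq_of_eq (hq : LocallyIntegrable q volume) {z : ℂ} {p x : ℝ}
    {φ v φ' v' : ℝ → ℂ} (h : SolvesBetween q z p x φ v) (h' : SolvesBetween q z p x φ' v')
    (hφ : φ p = φ' p) (hv : v p = v' p) : φ x = φ' x ∧ v x = v' x := by
  have hsub : ∀ s ∈ uIcc p x, uIcc p s ⊆ uIcc p x := fun s hs =>
    uIcc_subset_uIcc left_mem_uIcc hs
  have hmain : (fun s => (φ s - φ' s, v s - v' s)) x = 0 := by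
    refine eq_zero_of_norm_eq_integral (p := p)
      (f := fun t => (v t - v' t, ((q t : ℂ) - z) * (φ t - φ' t)))
      (locallyIntegrable_companion_bound hq z) (fun t => by positivity)
      ((h.continuousOn.sub h'.continuousOn).prodMk
        (h.continuousOn_deriv.sub h'.continuousOn_deriv))
      (fun s _ => norm_companion_le z s (φ s - φ' s, v s - v' s)) fun s hs => ?_
    have c1 := (h.continuousOn.mono (hsub s hs))
    have c2 := (h'.continuousOn.mono (hsub s hs))
    have d1 := (h.continuousOn_deriv.mono (hsub s hs)).intervalIntegrable (μ := volume)
    have d2 := (h'.continuousOn_deriv.mono (hsub s hs)).intervalIntegrable (μ := volume)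
    have i12 : IntervalIntegrable (fun t => ((q t : ℂ) - z) * (φ t - φ' t)) volume p s :=
      intervalIntegrable_sub_const_mul hq z (c1.sub c2)
    change (φ s - φ' s, v s - v' s) = _
    rw [integral_prodMk (d1.sub d2) i12,
      intervalIntegral.integral_sub d1 d2]
    simp only [mul_sub]
    rw [intervalIntegral.integral_sub (intervalIntegrable_sub_const_mul hq z c1)
      (intervalIntegrable_sub_const_mul hq z c2), h.eq_add s hs, h'.eq_add s hs,
      h.deriv_eq_add s hs, h'.deriv_eq_add s hs, hφ, hv]
    simp only [add_sub_add_left_eq_sub]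
  simp only [Prod.mk_eq_zero, sub_eq_zero] at hmain
  exact hmain

/-- Only the forcing between `p` and `x` matters. This lets a function that solves the homogeneous
equation on one interval only be compared there with a solution on the line. -/
theorem IsForcedSolution.solvesBetween {g φ v : ℝ → ℂ} (h : IsForcedSolution q g φ v) {z : ℂ}
    {p x : ℝ} (hg : ∀ᵐ t, t ∈ uIcc p x → g t = z * φ t) : SolvesBetween q z p x φ v := by
  refine ⟨h.continuous.continuousOn, h.continuous_deriv.continuousOn, fun s _ => ?_, fun s hs => ?_⟩
  · rw [intervalIntegral.integral_eq_sub_of_hasDerivAt (fun t _ => h.hasDerivAt t)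
      (h.continuous_deriv.intervalIntegrable _ _)]
    ring
  · have e : ∫ t in p..s, ((q t : ℂ) - z) * φ t = ∫ t in p..s, ((q t : ℂ) * φ t - g t) := by
      refine intervalIntegral.integral_congr_ae ?_
      filter_upwards [hg] with t ht hts
      rw [ht (uIcc_subset_uIcc left_mem_uIcc hs (uIoc_subset_uIcc hts))]
      ring
    rw [e, ← h.sub_eq]
    ring

/-- `φ` is a solution on the line of `-φ'' + q φ = z φ`, with derivative `v`. -/
abbrev IsGlobalSolution (q : ℝ → ℝ) (z : ℂ) (φ v : ℝ → ℂ) : Prop :=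
  IsForcedSolution q (fun t => z * φ t) φ v

theorem IsForcedSolution.congr_fun {g g' φ φ' v v' : ℝ → ℂ} (h : IsForcedSolution q g φ v)
    (hg : ∀ t, g' t = g t) (hφ : ∀ t, φ' t = φ t) (hv : ∀ t, v' t = v t) :
    IsForcedSolution q g' φ' v' := by
  rwa [funext hg, funext hφ, funext hv]

theorem IsGlobalSolution.linearCombination {z : ℂ} {φ v φ' v' : ℝ → ℂ}
    (h : IsGlobalSolution q z φ v) (h' : IsGlobalSolution q z φ' v') (c c' : ℂ) :
    IsGlobalSolution q z (fun t => c * φ t + c' * φ' t) (fun t => c * v t + c' * v' t) :=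
  ((h.const_mul c).add (h'.const_mul c')).congr_fun (fun t => by ring) (fun _ => rfl) fun _ => rfl

theorem IsGlobalSolution.ext (hq : LocallyIntegrable q volume) {z : ℂ} {φ v φ' v' : ℝ → ℂ}
    (h : IsGlobalSolution q z φ v) (h' : IsGlobalSolution q z φ' v') {p : ℝ}
    (hφ : φ p = φ' p) (hv : v p = v' p) : φ = φ' ∧ v = v' := by
  have := fun x => (h.solvesBetween (z := z) (p := p) (x := x) (by simp)).eq_of_eq hq
    (h'.solvesBetween (by simp)) hφ hv
  exact ⟨funext fun x => (this x).1, funext fun x => (this x).2⟩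

/-- Picard iteration for the companion system of the pair `(φ, φ')`, whose coefficient is bounded by
the locally integrable function `1 + |q| + ‖z‖`. -/
theorem exists_isGlobalSolution (hq : LocallyIntegrable q volume) (z : ℂ) (p : ℝ) (a b : ℂ) :
    ∃ φ v, IsGlobalSolution q z φ v ∧ φ p = a ∧ v p = b := by
  have hAi : ∀ Y : ℝ → ℂ × ℂ, Continuous Y → ∀ c d,
      IntervalIntegrable (fun s => ((Y s).2, ((q s : ℂ) - z) * (Y s).1)) volume c d := by
    intro Y hY c d
    have h1 := hY.snd.intervalIntegrable (μ := volume) c d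
    have h2 := intervalIntegrable_sub_const_mul hq z (hY.fst.continuousOn (s := uIcc c d))
    rw [intervalIntegrable_iff] at h1 h2 ⊢
    exact Integrable.prodMk h1 h2
  obtain ⟨Y, hY, hYe⟩ := exists_eq_add_integral (locallyIntegrable_companion_bound hq z)
    (fun t => by positivity) (A := fun t Y => (Y.2, ((q t : ℂ) - z) * Y.1))
    (fun t Y Y' => by
      have := norm_companion_le (q := q) z t (Y - Y')
      rw [Prod.fst_sub, Prod.snd_sub, mul_sub] at this
      exact this)
    (fun t => by simp) hAi p (a, b)
  have hint : ∀ c d, IntervalIntegrable (fun t => ((q t : ℂ) - z) * (Y t).1) volume c d :=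
    fun c d => intervalIntegrable_sub_const_mul hq z hY.fst.continuousOn
  have e : ∀ t, Y t = (a + ∫ s in p..t, (Y s).2, b + ∫ s in p..t, ((q s : ℂ) - z) * (Y s).1) := by
    intro t
    rw [hYe t, integral_prodMk (hY.snd.intervalIntegrable p t) (hint p t)]
    rfl
  have e1 : (fun t => (Y t).1) = fun t => a + ∫ s in p..t, (Y s).2 :=
    funext fun t => congrArg Prod.fst (e t)
  have e2 : ∀ t, (Y t).2 = b + ∫ s in p..t, ((q s : ℂ) - z) * (Y s).1 :=
    fun t => congrArg Prod.snd (e t)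
  have e3 : (fun t => (q t : ℂ) * (Y t).1 - z * (Y t).1) = fun t => ((q t : ℂ) - z) * (Y t).1 := by
    funext t; ring
  refine ⟨fun t => (Y t).1, fun t => (Y t).2, ⟨fun x => ?_, fun c d => ?_, fun c d => ?_⟩, ?_, ?_⟩
  · rw [e1]
    exact (intervalIntegral.integral_hasDerivAt_right (hY.snd.intervalIntegrable p x)
      (hY.snd.stronglyMeasurableAtFilter _ _) hY.snd.continuousAt).const_add a
  · rw [e3]
    exact hint c d
  · rw [e3, e2 c, e2 d, add_sub_add_left_eq_sub,
      intervalIntegral.integral_interval_sub_left (hint p d) (hint p c)]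
  · simp [e p]
  · simp [e p]

theorem IsSolution.solvesBetween (hq : LocallyIntegrable q volume) {z : ℂ} {I : Set ℝ}
    {y : ℝ → ℂ} (h : IsSolution q z I y) {p x : ℝ} (hpx : uIcc p x ⊆ I) :
    SolvesBetween q z p x y (derivWithin y I) := by
  have hy : ContinuousOn y (uIcc p x) := h.1.continuousOn.mono hpx
  have hv : ∀ s ∈ uIcc p x,
      derivWithin y I s = derivWithin y I p + ∫ t in p..s, ((q t : ℂ) - z) * y t := by
    intro s hs
    rw [← h.2 p (hpx left_mem_uIcc) s (hpx hs)]
    ring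
  have hvc : ContinuousOn (derivWithin y I) (uIcc p x) := by
    refine ContinuousOn.congr ?_ hv
    exact continuousOn_const.add (intervalIntegral.continuousOn_primitive_interval
      ((intervalIntegrable_iff' (by finiteness)).1
        (intervalIntegrable_sub_const_mul hq z hy)))
  refine ⟨hy, hvc, fun s hs => ?_, hv⟩
  have hsub : uIcc p s ⊆ uIcc p x := uIcc_subset_uIcc left_mem_uIcc hs
  -- At an end point of `I` the derivative is only one-sided. The fundamental theorem needs
  -- differentiability at interior points only, together with continuity up to the ends.
  rw [intervalIntegral.integral_eq_sub_of_hasDeriv_right (f := y) (hy.mono hsub) ?_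
    (hvc.mono hsub).intervalIntegrable]
  · ring
  · intro t ht
    have hI : I ∈ nhds t := Filter.mem_of_superset (Icc_mem_nhds ht.1 ht.2) (hsub.trans hpx)
    exact ((h.1 t (mem_of_mem_nhds hI)).hasDerivWithinAt.hasDerivAt hI).hasDerivWithinAt

theorem isSolution_univ_iff (hq : LocallyIntegrable q volume) {z : ℂ} {φ : ℝ → ℂ} :
    IsSolution q z univ φ ↔ IsGlobalSolution q z φ (deriv φ) := by
  have e : (fun t => (q t : ℂ) * φ t - z * φ t) = fun t => ((q t : ℂ) - z) * φ t := by
    funext t; ring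
  constructor
  · rintro ⟨h1, h2⟩
    rw [differentiableOn_univ] at h1
    refine ⟨fun x => (h1 x).hasDerivAt, fun a b => ?_, fun a b => ?_⟩
    · rw [e]
      exact intervalIntegrable_sub_const_mul hq z h1.continuous.continuousOn
    · rw [e, ← h2 a (mem_univ a) b (mem_univ b), derivWithin_univ]
  · intro h
    refine ⟨differentiableOn_univ.2 fun x => (h.hasDerivAt x).differentiableAt,
      fun a _ b _ => ?_⟩
    rw [derivWithin_univ, h.sub_eq, e]

/-- A solution on an interval is the restriction of a solution on the line. -/
theorem IsSolution.exists_extension (hq : LocallyIntegrable q volume) {z : ℂ} {I : Set ℝ}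
    [I.OrdConnected] {y : ℝ → ℂ} (h : IsSolution q z I y) {p : ℝ} (hp : p ∈ I) :
    ∃ φ v, IsGlobalSolution q z φ v ∧ EqOn φ y I ∧ v p = derivWithin y I p := by
  obtain ⟨φ, v, hφ, h1, h2⟩ := exists_isGlobalSolution hq z p (y p) (derivWithin y I p)
  refine ⟨φ, v, hφ, fun x hx => ?_, h2⟩
  exact ((hφ.solvesBetween (by simp)).eq_of_eq hq
    (h.solvesBetween hq (OrdConnected.uIcc_subset ‹_› hp hx)) h1 h2).1

theorem cauchySolution_spec (hq : LocallyIntegrable q volume) (z a b : ℂ) :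
    IsCauchySolution q z a b (cauchySolution q z a b) := by
  refine Classical.epsilon_spec (p := IsCauchySolution q z a b) ?_
  obtain ⟨φ, v, h, h1, h2⟩ := exists_isGlobalSolution hq z 0 a b
  refine ⟨φ, (isSolution_univ_iff hq).2 (h.deriv_eq ▸ h), h1, h.deriv_eq ▸ h2⟩

/-- The fundamental matrix propagates Cauchy data from `0` to `x`. -/
theorem fundamentalMatrix_mulVec (hq : LocallyIntegrable q volume) {z : ℂ} {φ v : ℝ → ℂ}
    {x : ℝ} (h : SolvesBetween q z 0 x φ v) :
    (fundamentalMatrix q z x).mulVec ![φ 0, v 0] = ![φ x, v x] := by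
  obtain ⟨h1, h2, h3⟩ := cauchySolution_spec hq z 1 0
  obtain ⟨h1', h2', h3'⟩ := cauchySolution_spec hq z 0 1
  have hc := IsGlobalSolution.linearCombination ((isSolution_univ_iff hq).1 h1)
    ((isSolution_univ_iff hq).1 h1') (φ 0) (v 0)
  obtain ⟨e1, e2⟩ := (hc.solvesBetween (p := 0) (x := x) (by simp)).eq_of_eq hq h
    (by simp [h2, h2']) (by simp [h3, h3'])
  rw [← e1, ← e2]
  ext i
  fin_cases i <;> simp [fundamentalMatrix, Matrix.mulVec, dotProduct, Fin.sum_univ_two, mul_comm]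

end ODE

/-! ### Multiplication of solutions by smooth cutoffs. -/

section Cutoff

/-- Here `u` is merely a primitive of an integrable function. Both factors are absolutely
continuous, so the product rule, valid almost everywhere, integrates back. -/
theorem real_mul_sub_mul_eq_integral {η η' u k : ℝ → ℝ} (hη : ∀ x, HasDerivAt η (η' x) x)
    (hη' : Continuous η') (hk : ∀ a b, IntervalIntegrable k volume a b)
    (hu : ∀ a b, u b - u a = ∫ t in a..b, k t) (a b : ℝ) :
    η b * u b - η a * u a = ∫ t in a..b, (η' t * u t + η t * k t) := by
  have hd : deriv η = η' := funext fun x => (hη x).deriv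
  have h1 : AbsolutelyContinuousOnInterval η a b := by
    refine ContDiffOn.absolutelyContinuousOnInterval (ContDiff.contDiffOn ?_)
    rw [contDiff_one_iff_deriv]
    exact ⟨fun x => (hη x).differentiableAt, hd ▸ hη'⟩
  have hu' : u = fun x => u a + ∫ t in a..x, k t := by
    funext x
    rw [← hu]
    ring
  have h2 : AbsolutelyContinuousOnInterval u a b := by
    rw [hu']
    have hc : AbsolutelyContinuousOnInterval (fun _ : ℝ => u a) a b :=
      ContDiffOn.absolutelyContinuousOnInterval contDiff_const.contDiffOn
    exact hc.add ((hk a b).absolutelyContinuousOnInterval_intervalIntegral left_mem_uIcc)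
  rw [← h1.integral_deriv_mul_eq_sub h2]
  refine intervalIntegral.integral_congr_ae ?_
  filter_upwards [(hk a b).ae_hasDerivAt_integral] with x hx hxab
  have hux : deriv u x = k x := by
    rw [hu']
    exact ((hx (uIoc_subset_uIcc hxab) a left_mem_uIcc).const_add (u a)).deriv
  rw [hd, hux]

theorem mul_sub_mul_eq_integral {η η' : ℝ → ℝ} (hη : ∀ x, HasDerivAt η (η' x) x)
    (hη' : Continuous η') {u k : ℝ → ℂ} (hk : ∀ a b, IntervalIntegrable k volume a b)
    (hu : ∀ a b, u b - u a = ∫ t in a..b, k t) (a b : ℝ) :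
    η b * u b - η a * u a = ∫ t in a..b, (η' t * u t + η t * k t) := by
  have hηc : Continuous η := continuous_iff_continuousAt.2 fun x => (hη x).continuousAt
  have huc : Continuous u := by
    have : u = fun x => u 0 + ∫ t in (0 : ℝ)..x, k t := by
      funext x
      rw [← hu]
      ring
    rw [this]
    exact continuous_const.add (intervalIntegral.continuous_primitive hk 0)
  have hint : IntervalIntegrable (fun t => (η' t : ℂ) * u t + η t * k t) volume a b := by
    refine (Continuous.intervalIntegrable (by fun_prop) a b).add ?_
    exact (hk a b).continuousOn_mul (Complex.continuous_ofReal.comp hηc).continuousOn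
  have hre : ∀ c d, IntervalIntegrable (fun t => (k t).re) volume c d := fun c d => by
    have := hk c d
    rw [intervalIntegrable_iff] at this ⊢
    exact this.re
  have him : ∀ c d, IntervalIntegrable (fun t => (k t).im) volume c d := fun c d => by
    have := hk c d
    rw [intervalIntegrable_iff] at this ⊢
    exact this.im
  have ere : ∀ {f : ℝ → ℂ} {c d : ℝ}, IntervalIntegrable f volume c d →
      (∫ t in c..d, f t).re = ∫ t in c..d, (f t).re := fun hf =>
    (Complex.reCLM.intervalIntegral_comp_comm hf).symm
  have eim : ∀ {f : ℝ → ℂ} {c d : ℝ}, IntervalIntegrable f volume c d →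
      (∫ t in c..d, f t).im = ∫ t in c..d, (f t).im := fun hf =>
    (Complex.imCLM.intervalIntegral_comp_comm hf).symm
  apply Complex.ext
  · rw [ere hint]
    simp only [Complex.sub_re, Complex.add_re, Complex.re_ofReal_mul]
    refine real_mul_sub_mul_eq_integral (u := fun t => (u t).re) hη hη' hre (fun c d => ?_) a b
    rw [← ere (hk c d), ← hu, Complex.sub_re]
  · rw [eim hint]
    simp only [Complex.sub_im, Complex.add_im, Complex.im_ofReal_mul]
    refine real_mul_sub_mul_eq_integral (u := fun t => (u t).im) hη hη' him (fun c d => ?_) a b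
    rw [← eim (hk c d), ← hu, Complex.sub_im]

/-- Leibniz' rule: `(η φ)'' = η φ'' + 2 η' φ' + η'' φ`. The extra terms vanish where `η` is
constant, so a cutoff turns a solution that is square integrable near one end into an element of the
domain of `L`. -/
theorem IsGlobalSolution.cutoff {q : ℝ → ℝ} {z : ℂ} {φ v : ℝ → ℂ} (h : IsGlobalSolution q z φ v)
    {η η' η'' : ℝ → ℝ} (hη : ∀ x, HasDerivAt η (η' x) x) (hη' : ∀ x, HasDerivAt η' (η'' x) x)
    (hη'' : Continuous η'') :
    IsForcedSolution q (fun t => z * (η t * φ t) - (η'' t * φ t + 2 * (η' t * v t)))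
      (fun t => η t * φ t) (fun t => η' t * φ t + η t * v t) := by
  have hηc : Continuous η := continuous_iff_continuousAt.2 fun x => (hη x).continuousAt
  have hη'c : Continuous η' := continuous_iff_continuousAt.2 fun x => (hη' x).continuousAt
  have hφc := h.continuous
  have hvc := h.continuous_deriv
  have hc : Continuous fun t => (η'' t : ℂ) * φ t + η' t * v t := by fun_prop
  have hi1 : ∀ a b, IntervalIntegrable (fun t => (η'' t : ℂ) * φ t + η' t * v t) volume a b :=
    fun a b => hc.intervalIntegrable a b
  have hi2 : ∀ a b, IntervalIntegrable
      (fun t => (η' t : ℂ) * v t + η t * ((q t : ℂ) * φ t - z * φ t)) volume a b := fun a b =>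
    (Continuous.intervalIntegrable (by fun_prop) a b).add
      ((h.intervalIntegrable a b).continuousOn_mul (Complex.continuous_ofReal.comp hηc).continuousOn)
  have e : (fun t => (q t : ℂ) * (η t * φ t) -
      (z * (η t * φ t) - (η'' t * φ t + 2 * (η' t * v t)))) =
      fun t => ((η'' t : ℂ) * φ t + η' t * v t) +
        ((η' t : ℂ) * v t + η t * ((q t : ℂ) * φ t - z * φ t)) := by
    funext t; ring
  refine ⟨fun x => (hη x).ofReal_comp.mul (h.hasDerivAt x), fun a b => ?_, fun a b => ?_⟩
  · rw [e]
    exact (hi1 a b).add (hi2 a b)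
  · rw [e, intervalIntegral.integral_add (hi1 a b) (hi2 a b),
      ← mul_sub_mul_eq_integral hη hη'c h.intervalIntegrable h.sub_eq,
      intervalIntegral.integral_eq_sub_of_hasDerivAt
        (fun t _ => (hη' t).ofReal_comp.mul (h.hasDerivAt t)) (hi1 a b)]
    simp only [Pi.mul_apply]
    ring

end Cutoff

/-! ### The graph of the operator and the subspaces of functions supported on a set. -/

section L2

theorem graph_schrodingerOp (q : ℝ → ℝ) : (schrodingerOp q).graph = schrodingerGraph q :=
  Submodule.toLinearPMap_graph_eq _ fun p hp h0 => schrodingerGraph_single_valued q p hp h0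

theorem mem_graph_schrodingerOp_iff {q : ℝ → ℝ} {y g : L2} :
    (y, g) ∈ (schrodingerOp q).graph ↔
      ∃ φ v : ℝ → ℂ, (y : ℝ → ℂ) =ᵐ[volume] φ ∧ IsForcedSolution q g φ v := by
  rw [graph_schrodingerOp]
  constructor
  · rintro ⟨φ, h1, h2, h3⟩
    exact ⟨φ, deriv φ, h1, fun x => (h2 x).hasDerivAt, fun a b => (h3 a b).1, fun a b => (h3 a b).2⟩
  · rintro ⟨φ, v, h1, h2⟩
    refine ⟨φ, h1, fun x => (h2.hasDerivAt x).differentiableAt, fun a b =>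
      ⟨h2.intervalIntegrable a b, ?_⟩⟩
    rw [h2.deriv_eq]
    exact h2.sub_eq a b

theorem memLp_indicator_Icc {f : ℝ → ℂ} (hf : Continuous f) (a b : ℝ) :
    MemLp ((Icc a b).indicator f) 2 volume := by
  rw [memLp_indicator_iff_restrict measurableSet_Icc]
  obtain ⟨C, hC⟩ := isCompact_Icc.exists_bound_of_continuousOn (hf.continuousOn (s := Icc a b))
  exact MemLp.of_bound hf.aestronglyMeasurable C
    ((ae_restrict_iff' measurableSet_Icc).2 (Filter.Eventually.of_forall hC))

theorem memLp_of_memLp_indicator {f : ℝ → ℂ} (hf : Continuous f) {a b : ℝ}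
    (ha : MemLp ((Iic a).indicator f) 2 volume) (hb : MemLp ((Ici b).indicator f) 2 volume) :
    MemLp f 2 volume := by
  have h1 := memLp_indicator_Icc hf a b
  refine ((ha.norm.add hb.norm).add h1.norm).mono hf.aestronglyMeasurable
    (Filter.Eventually.of_forall fun x => ?_)
  simp only [Pi.add_apply]
  rw [Real.norm_of_nonneg (by positivity)]
  by_cases hxa : x ≤ a
  · rw [indicator_of_mem (show x ∈ Iic a from hxa)]
    linarith [norm_nonneg ((Ici b).indicator f x), norm_nonneg ((Icc a b).indicator f x)]
  · by_cases hxb : b ≤ x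
    · rw [indicator_of_mem (show x ∈ Ici b from hxb)]
      linarith [norm_nonneg ((Iic a).indicator f x), norm_nonneg ((Icc a b).indicator f x)]
    · rw [indicator_of_mem (show x ∈ Icc a b from ⟨(not_le.1 hxa).le, (not_le.1 hxb).le⟩)]
      linarith [norm_nonneg ((Iic a).indicator f x), norm_nonneg ((Ici b).indicator f x)]

theorem inner_eq_zero_of_mem_l2On {I J : Set ℝ} (hIJ : volume (I ∩ J) = 0) {f g : L2}
    (hf : f ∈ l2On I) (hg : g ∈ l2On J) : inner ℂ f g = 0 := by
  rw [L2.inner_def]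
  have hn : ∀ᵐ x ∂(volume : Measure ℝ), x ∉ I ∩ J := measure_eq_zero_iff_ae_notMem.1 hIJ
  refine integral_eq_zero_of_ae ?_
  filter_upwards [hf, hg, hn] with x h1 h2 h3
  by_cases hx : x ∈ I
  · rw [h2 fun hJ => h3 ⟨hx, hJ⟩, inner_zero_right]
    rfl
  · rw [h1 hx, inner_zero_left]
    rfl

theorem mem_l2On_of_ae_eq_indicator {I : Set ℝ} {f : L2} {φ : ℝ → ℂ}
    (h : (f : ℝ → ℂ) =ᵐ[volume] I.indicator φ) : f ∈ l2On I := by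
  filter_upwards [h] with x hx hxI
  rw [hx, indicator_of_notMem hxI]

/-- The subspace is the kernel of the continuous restriction to the complement of `I`. -/
theorem isClosed_l2On {I : Set ℝ} (hI : MeasurableSet I) : IsClosed (l2On I : Set L2) := by
  have : (l2On I : Set L2) =
      (LpToLpRestrictCLM ℝ ℂ ℂ volume 2 Iᶜ) ⁻¹' {0} := by
    ext f
    rw [mem_preimage, mem_singleton_iff, Lp.eq_zero_iff_ae_eq_zero]
    have h := LpToLpRestrictCLM_coeFn ℂ Iᶜ f
    constructor
    · intro hf
      have hf' : ∀ᵐ x ∂(volume : Measure ℝ), x ∈ Iᶜ → f x = 0 := hf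
      filter_upwards [h, (ae_restrict_iff' hI.compl).2 hf'] with x h1 h2
      rw [h1, h2]
      rfl
    · intro hf
      have : ∀ᵐ x ∂(volume.restrict Iᶜ), f x = 0 := by
        filter_upwards [h, hf] with x h1 h2
        rw [← h1, h2]
        rfl
      exact (ae_restrict_iff' hI.compl).1 this
  rw [this]
  exact isClosed_singleton.preimage (ContinuousLinearMap.continuous _)

theorem extendL2_ae_eq {q : ℝ → ℝ} {z : ℂ} {I : Set ℝ} {y : ℝ → ℂ}
    (h : IsNormalizedSolution q z I y) :
    (extendL2 I y : ℝ → ℂ) =ᵐ[volume] I.indicator y := by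
  unfold extendL2
  rw [dif_pos h.memLp]
  exact h.memLp.coeFn_toLp

theorem extendL2_mem_l2On {q : ℝ → ℝ} {z : ℂ} {I : Set ℝ} {y : ℝ → ℂ}
    (h : IsNormalizedSolution q z I y) : extendL2 I y ∈ l2On I :=
  mem_l2On_of_ae_eq_indicator (extendL2_ae_eq h)

theorem norm_extendL2 {q : ℝ → ℝ} {z : ℂ} {I : Set ℝ} (hI : MeasurableSet I) {y : ℝ → ℂ}
    (h : IsNormalizedSolution q z I y) : ‖extendL2 I y‖ = 1 := by
  have h1 : inner ℂ (extendL2 I y) (extendL2 I y) = ((∫ x in I, ‖y x‖ ^ 2 : ℝ) : ℂ) := by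
    rw [L2.inner_def, ← integral_indicator hI, ← integral_complex_ofReal]
    refine integral_congr_ae ?_
    filter_upwards [extendL2_ae_eq h] with x hx
    rw [hx]
    by_cases hxI : x ∈ I
    · simp [hxI, inner_self_eq_norm_sq_to_K]
    · simp [hxI]
  rw [h.norm_eq, inner_self_eq_norm_sq_to_K] at h1
  have h2 : ‖extendL2 I y‖ ^ 2 = 1 := Complex.ofReal_injective (by push_cast; exact h1)
  exact (pow_eq_one_iff_of_nonneg (norm_nonneg _) two_ne_zero).1 h2

end L2

/-- Exchanging `z` with `z̄` and `f` with `g` leaves the graph condition of `cayley_eq_iff`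
unchanged: the domain element is the same, and `f + z y = g + z̄ y`. -/
theorem cayley_cayley_conj {H : Type*} [NormedAddCommGroup H] [InnerProductSpace ℂ H]
    [CompleteSpace H] {A : H →ₗ.[ℂ] H} (hA : IsSelfAdjoint A) {z : ℂ} (hz : z.im ≠ 0) (g : H) :
    cayley A z (cayley A (conj z) g) = g := by
  have hδ := sub_conj_ne_zero hz
  have hz' : (conj z).im ≠ 0 := by simpa using hz
  have h := (cayley_eq_iff hA hz' g _).1 rfl
  rw [cayley_eq_iff hA hz]
  generalize cayley A (conj z) g = f at h ⊢
  rw [Complex.conj_conj] at h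
  have e1 : (conj z - z)⁻¹ • (f - g) = (z - conj z)⁻¹ • (g - f) := by
    rw [← neg_sub z, ← neg_sub g, inv_neg, neg_smul_neg]
  rw [e1] at h
  convert h using 2
  have : (z - conj z) • (z - conj z)⁻¹ • (g - f) = g - f := by
    rw [smul_smul, mul_inv_cancel₀ hδ, one_smul]
  rw [sub_smul, sub_eq_sub_iff_add_eq_add] at this
  rw [add_comm, this]

/-! ### Square integrable solutions on half-lines and the invariance of the node spaces. -/

section HalfLine

variable {q : ℝ → ℝ}

/-- `y ∈ L²(ℝ)` is the restriction to `I`, extended by zero, of the solution `φ` of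
`-φ'' + q φ = z φ` on the line, with derivative `v`. -/
structure IsTail (q : ℝ → ℝ) (z : ℂ) (I : Set ℝ) (φ v : ℝ → ℂ) (y : L2) : Prop where
  isGlobalSolution : IsGlobalSolution q z φ v
  ae_eq : (y : ℝ → ℂ) =ᵐ[volume] I.indicator φ

theorem IsTail.memLp {z : ℂ} {I : Set ℝ} {φ v : ℝ → ℂ} {y : L2} (h : IsTail q z I φ v y) :
    MemLp (I.indicator φ) 2 volume :=
  (memLp_congr_ae h.ae_eq).1 (Lp.memLp y)

theorem IsTail.ne_zero {z : ℂ} {I : Set ℝ} {φ v : ℝ → ℂ} {y : L2} (h : IsTail q z I φ v y)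
    (hy : ‖y‖ = 1) : φ ≠ 0 := by
  rintro rfl
  have : y = 0 := Lp.ext (h.ae_eq.trans (by
    rw [indicator_zero']
    exact (Lp.coeFn_zero ℂ 2 volume).symm))
  rw [this, norm_zero] at hy
  exact zero_ne_one hy

theorem IsNormalizedSolution.exists_isTail (hq : LocallyIntegrable q volume) {z : ℂ} {I : Set ℝ}
    [I.OrdConnected] {y : ℝ → ℂ} (h : IsNormalizedSolution q z I y) {p : ℝ} (hp : p ∈ I) :
    ∃ φ v, IsTail q z I φ v (extendL2 I y) ∧ φ p = y p ∧ v p = derivWithin y I p := by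
  obtain ⟨φ, v, h1, h2, h3⟩ := h.isSolution.exists_extension hq hp
  exact ⟨φ, v, ⟨h1, (extendL2_ae_eq h).trans (indicator_congr h2.symm).eventuallyEq⟩, h2 hp, h3⟩

/-- Such a solution would otherwise be an eigenvector of a self-adjoint operator at a nonreal
eigenvalue. -/
theorem IsGlobalSolution.eq_zero_of_memLp (hL : IsSelfAdjoint (schrodingerOp q)) {z : ℂ}
    (hz : z.im ≠ 0) {φ v : ℝ → ℂ} (h : IsGlobalSolution q z φ v) (hφ : MemLp φ 2 volume) :
    φ = 0 := by
  have hmem : (hφ.toLp φ, z • hφ.toLp φ) ∈ (schrodingerOp q).graph := by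
    refine mem_graph_schrodingerOp_iff.2 ⟨φ, v, hφ.coeFn_toLp, h.congr_ae ?_⟩
    filter_upwards [Lp.coeFn_smul z (hφ.toLp φ), hφ.coeFn_toLp] with t h1 h2
    rw [h1, Pi.smul_apply, h2, smul_eq_mul]
  have h1 := abs_im_mul_norm_le hL z hmem
  simp only [sub_self, norm_zero] at h1
  have h2 : hφ.toLp φ = 0 := norm_eq_zero.1
    (le_antisymm (nonpos_of_mul_nonpos_right h1 (abs_pos.2 hz)) (norm_nonneg _))
  have h3 : φ =ᵐ[volume] (0 : ℝ → ℂ) := by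
    refine hφ.coeFn_toLp.symm.trans ?_
    rw [h2]
    exact Lp.coeFn_zero ℂ 2 volume
  exact (h.continuous.ae_eq_iff_eq volume continuous_const).1 h3

/-- At a nonreal spectral point, the square integrable solutions on a half-line form a line. -/
theorem IsGlobalSolution.exists_eq_const_mul (hq : LocallyIntegrable q volume)
    (hL : IsSelfAdjoint (schrodingerOp q)) {z : ℂ} (hz : z.im ≠ 0) {I J : Set ℝ}
    (hIJ : ∀ f : ℝ → ℂ, Continuous f → MemLp (I.indicator f) 2 volume →
      MemLp (J.indicator f) 2 volume → MemLp f 2 volume)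
    {e e' w w' m m' : ℝ → ℂ} (he : IsGlobalSolution q z e e') (hw : IsGlobalSolution q z w w')
    (hm : IsGlobalSolution q z m m') (he0 : e ≠ 0) (hm0 : m ≠ 0)
    (heI : MemLp (I.indicator e) 2 volume) (hwI : MemLp (I.indicator w) 2 volume)
    (hmJ : MemLp (J.indicator m) 2 volume) : ∃ c : ℂ, ∀ t, w t = c * e t := by
  have hsmul : ∀ c : ℂ, w 0 = c * e 0 → w' 0 = c * e' 0 → ∃ c : ℂ, ∀ t, w t = c * e t := by
    intro c h1 h2
    have := (hw.ext hq (IsGlobalSolution.linearCombination he he c 0) (p := 0) (by simpa using h1)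
      (by simpa using h2)).1
    exact ⟨c, fun t => by rw [this]; ring⟩
  -- If the Wronskian vanishes, `w` is a multiple of `e`. Otherwise `e` and `w` span all solutions,
  -- so `m`, square integrable on `J`, would be so on `I` too, hence on the line.
  by_cases hD : e 0 * w' 0 - e' 0 * w 0 = 0
  · by_cases h0 : e 0 = 0
    · have h0' : e' 0 ≠ 0 := fun h0' => by
        refine he0 (he.ext hq (p := 0) (φ' := 0) (v' := 0) ?_ h0 h0').1
        exact IsForcedSolution.zero.congr_fun (fun t => by simp) (fun _ => rfl) fun _ => rfl
      have hw0 : w 0 = 0 := by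
        rw [h0, zero_mul, zero_sub, neg_eq_zero, mul_eq_zero] at hD
        exact hD.resolve_left h0'
      exact hsmul (w' 0 / e' 0) (by rw [hw0, h0, mul_zero]) (by field_simp)
    · refine hsmul (w 0 / e 0) (by field_simp) ?_
      field_simp
      linear_combination hD
  · exfalso
    -- Cramer's rule for the coefficients of `m` in terms of `e` and `w`.
    obtain ⟨α, hα⟩ : ∃ α, α * (e 0 * w' 0 - e' 0 * w 0) = m 0 * w' 0 - m' 0 * w 0 :=
      ⟨_, div_mul_cancel₀ _ hD⟩
    obtain ⟨β, hβ⟩ : ∃ β, β * (e 0 * w' 0 - e' 0 * w 0) = e 0 * m' 0 - e' 0 * m 0 :=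
      ⟨_, div_mul_cancel₀ _ hD⟩
    have hmc := (hm.ext hq (IsGlobalSolution.linearCombination he hw α β) (p := 0)
      (mul_left_cancel₀ hD (by linear_combination (-e 0) * hα - w 0 * hβ))
      (mul_left_cancel₀ hD (by linear_combination (-e' 0) * hα - w' 0 * hβ))).1
    have hmI : MemLp (I.indicator m) 2 volume := by
      have := (heI.const_mul α).add (hwI.const_mul β)
      convert this using 1
      funext t
      by_cases ht : t ∈ I
      · simp [ht, hmc]
      · simp [ht]
    exact hm0 (hm.eq_zero_of_memLp hL hz (hIJ m hm.continuous hmI hmJ))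

/-- The Cayley transform maps data proportional on `I` to the square integrable solution at `z̄` to
data proportional there to the square integrable solution at `z`. -/
theorem exists_add_smul_ae_eq (hq : LocallyIntegrable q volume)
    (hL : IsSelfAdjoint (schrodingerOp q)) {z : ℂ} (hz : z.im ≠ 0) {I J : Set ℝ}
    [I.OrdConnected]
    (hIJ : ∀ f : ℝ → ℂ, Continuous f → MemLp (I.indicator f) 2 volume →
      MemLp (J.indicator f) 2 volume → MemLp f 2 volume)
    (hI : MeasurableSet I) {p : ℝ} (hp : p ∈ I)
    {e e' b b' m m' : ℝ → ℂ} {e₀ b₀ m₀ : L2} (he : IsTail q z I e e' e₀)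
    (hb : IsTail q (conj z) I b b' b₀) (hm : IsTail q z J m m' m₀) (he0 : e ≠ 0) (hm0 : m ≠ 0)
    {f y : L2} {c : ℂ} (hf : ∀ᵐ x ∂(volume : Measure ℝ), x ∈ I → f x = c * b x)
    (hy : (y, f + z • y) ∈ (schrodingerOp q).graph) :
    ∃ t : ℂ, ∀ᵐ x ∂(volume : Measure ℝ), x ∈ I → f x + (z - conj z) * y x = t * e x := by
  have hδ := sub_conj_ne_zero hz
  obtain ⟨φ, v, hyφ, hφ⟩ := mem_graph_schrodingerOp_iff.1 hy
  -- Because `b` solves the equation at `z̄`, `-d b` is a particular solution of `(L - z) y = c b`.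
  -- Hence `y + d b` solves the homogeneous equation at `z` on `I`.
  set d := (z - conj z)⁻¹ * c with hd
  have hdc : d * (z - conj z) = c := by rw [hd]; field_simp
  have hs := hφ.add (hb.isGlobalSolution.const_mul d)
  -- Off `I` nothing is known about `f`, so the homogeneous solution on `I` is first continued to
  -- the whole line.
  obtain ⟨w, w', hw, hw1, hw2⟩ := exists_isGlobalSolution hq z p (φ p + d * b p) (v p + d * b' p)
  have hwI : ∀ x ∈ I, w x = φ x + d * b x := by
    intro x hx
    refine ((hw.solvesBetween (z := z) (by simp)).eq_of_eq hq (hs.solvesBetween ?_) hw1 hw2).1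
    filter_upwards [hf, hyφ, Lp.coeFn_add f (z • y), Lp.coeFn_smul z y] with t h1 h2 h3 h4 ht
    rw [h3, Pi.add_apply, h4, Pi.smul_apply, h1 (OrdConnected.uIcc_subset ‹_› hp hx ht), h2,
      smul_eq_mul, ← hdc]
    ring
  have hwL : MemLp (I.indicator w) 2 volume := by
    have h1 : MemLp (I.indicator y) 2 volume := (Lp.memLp y).indicator hI
    refine (memLp_congr_ae ?_).1 (h1.add (hb.memLp.const_mul d))
    filter_upwards [hyφ] with x hx
    by_cases hxI : x ∈ I
    · simp [hxI, hwI x hxI, hx]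
    · simp [hxI]
  obtain ⟨t, ht⟩ := he.isGlobalSolution.exists_eq_const_mul hq hL hz hIJ hw hm.isGlobalSolution
    he0 hm0 he.memLp hwL hm.memLp
  refine ⟨(z - conj z) * t, ?_⟩
  filter_upwards [hf, hyφ] with x h1 h2 hx
  rw [h1 hx, h2, mul_assoc, ← ht, hwI x hx, ← hdc]
  ring

theorem memLp_of_indicator_Iic_Ici {x₀ : ℝ} (f : ℝ → ℂ) (hf : Continuous f)
    (h1 : MemLp ((Iic 0).indicator f) 2 volume) (h2 : MemLp ((Ici x₀).indicator f) 2 volume) :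
    MemLp f 2 volume := memLp_of_memLp_indicator hf h1 h2

theorem eq_add_of_mem_sup_span_pair {V : Submodule ℂ L2} {a b f : L2}
    (hf : f ∈ V ⊔ Submodule.span ℂ {a, b}) : ∃ k ∈ V, ∃ c d : ℂ, f = k + (c • a + d • b) := by
  obtain ⟨k, hk, w, hw, rfl⟩ := Submodule.mem_sup.1 hf
  obtain ⟨c, d, rfl⟩ := Submodule.mem_span_pair.1 hw
  exact ⟨k, hk, c, d, rfl⟩

/-- Apply `exists_add_smul_ae_eq` on each half-line: the image is a multiple of the solution at `z`
there, and what remains is supported on `[0, x₀]`. The hypotheses are symmetric in `z` and `z'`, so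
that interchanging them yields the inclusion for the inverse map. -/
theorem cayley_mem_sup (hq : LocallyIntegrable q volume)
    (hL : IsSelfAdjoint (schrodingerOp q)) {z z' : ℂ} (hz : z.im ≠ 0) (hz' : z' = conj z) {x₀ : ℝ}
    (hx₀ : 0 < x₀) {m m' n n' e e' b b' : ℝ → ℂ} {m₀ n₀ e₀ b₀ : L2}
    (hm : IsTail q z (Iic 0) m m' m₀) (hn : IsTail q z' (Iic 0) n n' n₀)
    (he : IsTail q z (Ici x₀) e e' e₀) (hb : IsTail q z' (Ici x₀) b b' b₀)
    (hm0 : m ≠ 0) (he0 : e ≠ 0) {f : L2}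
    (hf : f ∈ l2On (Icc 0 x₀) ⊔ Submodule.span ℂ {n₀, b₀}) :
    cayley (schrodingerOp q) z f ∈ l2On (Icc 0 x₀) ⊔ Submodule.span ℂ {m₀, e₀} := by
  subst hz'
  obtain ⟨k, hk, c, d, hfk⟩ := eq_add_of_mem_sup_span_pair hf
  have hk' : ∀ᵐ x ∂(volume : Measure ℝ), x ∉ Icc 0 x₀ → k x = 0 := hk
  have hfx : ∀ᵐ x ∂(volume : Measure ℝ), f x =
      k x + (c * (Iic 0).indicator n x + d * (Ici x₀).indicator b x) := by
    rw [hfk]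
    filter_upwards [Lp.coeFn_add k (c • n₀ + d • b₀), Lp.coeFn_add (c • n₀) (d • b₀),
      Lp.coeFn_smul c n₀, Lp.coeFn_smul d b₀, hn.ae_eq, hb.ae_eq] with x h1 h2 h3 h4 h5 h6
    rw [h1, Pi.add_apply, h2, Pi.add_apply, h3, h4, Pi.smul_apply, Pi.smul_apply, h5, h6,
      smul_eq_mul, smul_eq_mul]
  have hne : ∀ a : ℝ, ∀ᵐ x ∂(volume : Measure ℝ), x ≠ a := fun a =>
    Measure.ae_ne volume a
  have hfl : ∀ᵐ x ∂(volume : Measure ℝ), x ∈ Iic 0 → f x = c * n x := by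
    filter_upwards [hfx, hk', hne 0] with x h1 h2 h3 hx
    have hx0 : x < 0 := lt_of_le_of_ne hx h3
    rw [h1, h2 fun h => absurd h.1 (not_le.2 hx0), indicator_of_mem hx,
      indicator_of_notMem (show x ∉ Ici x₀ from not_le.2 (hx0.trans hx₀))]
    ring
  have hfr : ∀ᵐ x ∂(volume : Measure ℝ), x ∈ Ici x₀ → f x = d * b x := by
    filter_upwards [hfx, hk', hne x₀] with x h1 h2 h3 hx
    have hx0 : x₀ < x := lt_of_le_of_ne hx (Ne.symm h3)
    rw [h1, h2 fun h => absurd h.2 (not_le.2 hx0), indicator_of_mem hx,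
      indicator_of_notMem (show x ∉ Iic 0 from not_le.2 (hx₀.trans hx0))]
    ring
  have hy := (resolventOp_eq_iff hL hz f _).1 rfl
  set y := resolventOp (schrodingerOp q) z f with hyd
  obtain ⟨s, hs⟩ := exists_add_smul_ae_eq hq hL hz memLp_of_indicator_Iic_Ici measurableSet_Iic
    (mem_Iic.2 le_rfl) hm hn he hm0 he0 hfl hy
  obtain ⟨t, ht⟩ := exists_add_smul_ae_eq hq hL hz
    (fun f hf h1 h2 => memLp_of_indicator_Iic_Ici f hf h2 h1) measurableSet_Ici
    (mem_Ici.2 le_rfl) he hb hm he0 hm0 hfr hy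
  have hg : cayley (schrodingerOp q) z f = f + (z - conj z) • y := rfl
  have hK : cayley (schrodingerOp q) z f - (s • m₀ + t • e₀) ∈ l2On (Icc 0 x₀) := by
    rw [hg]
    change ∀ᵐ x ∂(volume : Measure ℝ), x ∉ Icc 0 x₀ → _
    filter_upwards [hs, ht, Lp.coeFn_sub (f + (z - conj z) • y) (s • m₀ + t • e₀),
      Lp.coeFn_add f ((z - conj z) • y), Lp.coeFn_smul (z - conj z) y,
      Lp.coeFn_add (s • m₀) (t • e₀), Lp.coeFn_smul s m₀, Lp.coeFn_smul t e₀, hm.ae_eq,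
      he.ae_eq] with x h1 h2 h3 h4 h5 h6 h7 h8 h9 h10 hx
    rw [h3, Pi.sub_apply, h4, h6, Pi.add_apply, Pi.add_apply, h5, h7, h8, Pi.smul_apply,
      Pi.smul_apply, Pi.smul_apply, h9, h10, smul_eq_mul, smul_eq_mul, smul_eq_mul]
    rcases lt_or_ge x 0 with h0 | h0
    · have hx1 : x ∈ Iic 0 := h0.le
      rw [h1 hx1, indicator_of_mem hx1,
        indicator_of_notMem (show x ∉ Ici x₀ from not_le.2 (h0.trans hx₀))]
      ring
    · have hx2 : x₀ < x := not_le.1 fun h => hx ⟨h0, h⟩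
      have hx1 : x ∈ Ici x₀ := hx2.le
      rw [h2 hx1, indicator_of_mem hx1,
        indicator_of_notMem (show x ∉ Iic 0 from not_le.2 (hx₀.trans hx2))]
      ring
  rw [← sub_add_cancel (cayley (schrodingerOp q) z f) (s • m₀ + t • e₀)]
  exact Submodule.add_mem_sup hK (Submodule.mem_span_pair.2 ⟨s, t, rfl⟩)

end HalfLine

/-! ### Independence of the Cauchy data at `x₀`, and the Cayley transform as matching of Cauchy
data. -/

section Matching

variable {q : ℝ → ℝ}

theorem IsTail.const_smul {z : ℂ} {I : Set ℝ} {φ v : ℝ → ℂ} {y : L2} (h : IsTail q z I φ v y)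
    (c : ℂ) : IsTail q z I (fun t => c * φ t) (fun t => c * v t) (c • y) := by
  refine ⟨(h.isGlobalSolution.const_mul c).congr_fun (fun t => by ring) (fun _ => rfl)
    fun _ => rfl, ?_⟩
  filter_upwards [Lp.coeFn_smul c y, h.ae_eq] with x h1 h2
  rw [h1, Pi.smul_apply, h2, smul_eq_mul]
  by_cases hx : x ∈ I <;> simp [hx]

theorem exists_cutoff (x₀ : ℝ) : ∃ η η' η'' : ℝ → ℝ, (∀ x, HasDerivAt η (η' x) x) ∧
    (∀ x, HasDerivAt η' (η'' x) x) ∧ Continuous η'' ∧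
    (∀ x ≥ x₀, η x = 1 ∧ η' x = 0 ∧ η'' x = 0) ∧
    ∀ x ≤ x₀ - 3, η x = 0 ∧ η' x = 0 ∧ η'' x = 0 := by
  -- The transition takes place in `[x₀ - 2, x₀ - 1]`, so `η` is constant near every point of `[x₀,
  -- ∞)` and of `(-∞, x₀ - 3]`, and its derivatives vanish at the end points as well.
  set η : ℝ → ℝ := fun x => Real.smoothTransition (x - x₀ + 2) with hη
  have hc : ContDiff ℝ 2 η := by
    refine Real.smoothTransition.contDiff.comp ?_
    fun_prop
  have hc1 : ContDiff ℝ 1 (deriv η) := by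
    rw [show (2 : WithTop ℕ∞) = 1 + 1 by norm_num, contDiff_succ_iff_deriv] at hc
    exact hc.2.2
  have hd : ∀ x, HasDerivAt η (deriv η x) x := fun x =>
    (hc.differentiable (by norm_num) x).hasDerivAt
  have hd1 : ∀ x, HasDerivAt (deriv η) (deriv (deriv η) x) x := fun x =>
    (hc1.differentiable (by norm_num) x).hasDerivAt
  have hd2 : Continuous (deriv (deriv η)) := hc1.continuous_deriv le_rfl
  have hconst : ∀ (c x : ℝ), η =ᶠ[nhds x] (fun _ => c) →
      η x = c ∧ deriv η x = 0 ∧ deriv (deriv η) x = 0 := by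
    intro c x h
    refine ⟨h.eq_of_nhds, ?_, ?_⟩
    · rw [h.deriv_eq, deriv_const]
    · have := h.deriv
      rw [this.deriv_eq]
      simp
  refine ⟨η, deriv η, deriv (deriv η), hd, hd1, hd2, fun x hx => hconst 1 x ?_,
    fun x hx => hconst 0 x ?_⟩
  · filter_upwards [Ioi_mem_nhds (show x₀ - 1 < x by linarith)] with t ht
    rw [mem_Ioi] at ht
    exact Real.smoothTransition.one_of_one_le (by linarith)
  · filter_upwards [Iio_mem_nhds (show x < x₀ - 2 by linarith)] with t ht
    rw [mem_Iio] at ht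
    exact Real.smoothTransition.zero_of_nonpos (by linarith)

/-- With equal Cauchy data, `a - b` on `[x₀, ∞)` continued by zero is the domain element `α - β`,
with `L (α - β) = z α - z̄ β`. Symmetry of `L` is tested against a domain element that coincides
with `a` on `[x₀, ∞)`, obtained by cutting `a` off to the left. -/
theorem IsTail.eq_zero_of_eq (hL : IsSelfAdjoint (schrodingerOp q)) {z z' : ℂ} (hz : z.im ≠ 0)
    (hz' : z' = conj z) {x₀ : ℝ} {a a' b b' : ℝ → ℂ} {α β : L2} (ha : IsTail q z (Ici x₀) a a' α)
    (hb : IsTail q z' (Ici x₀) b b' β) (hab : a x₀ = b x₀) (hab' : a' x₀ = b' x₀) : α = 0 := by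
  have hne : ∀ᵐ x ∂(volume : Measure ℝ), x ≠ x₀ := Measure.ae_ne volume x₀
  have hglue := IsForcedSolution.zero.glue
    (ha.isGlobalSolution.add (hb.isGlobalSolution.const_mul (-1))) (p := x₀)
    (by rw [hab]; ring) (by rw [hab']; ring)
  have hmem : (α - β, z • α - z' • β) ∈ (schrodingerOp q).graph := by
    refine mem_graph_schrodingerOp_iff.2 ⟨_, _, ?_, hglue.congr_ae ?_⟩
    · filter_upwards [hne, Lp.coeFn_sub α β, ha.ae_eq, hb.ae_eq] with x h1 h2 h3 h4
      rw [h2, Pi.sub_apply, h3, h4]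
      by_cases hx : x ≤ x₀
      · have : x ∉ Ici x₀ := not_le.2 (lt_of_le_of_ne hx h1)
        simp [hx, this]
      · have : x ∈ Ici x₀ := (not_le.1 hx).le
        rw [if_neg hx, indicator_of_mem this, indicator_of_mem this]
        ring
    · filter_upwards [hne, Lp.coeFn_sub (z • α) (z' • β), Lp.coeFn_smul z α, Lp.coeFn_smul z' β,
        ha.ae_eq, hb.ae_eq] with x h1 h2 h3 h4 h5 h6
      rw [h2, Pi.sub_apply, h3, h4, Pi.smul_apply, Pi.smul_apply, h5, h6, smul_eq_mul, smul_eq_mul]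
      by_cases hx : x ≤ x₀
      · have : x ∉ Ici x₀ := not_le.2 (lt_of_le_of_ne hx h1)
        simp [hx, this]
      · have : x ∈ Ici x₀ := (not_le.1 hx).le
        rw [if_neg hx, indicator_of_mem this, indicator_of_mem this]
        ring
  obtain ⟨η, η', η'', h1, h2, h3, hr, hl⟩ := exists_cutoff x₀
  have hcut := ha.isGlobalSolution.cutoff h1 h2 h3
  have hηc : Continuous η := continuous_iff_continuousAt.2 fun x => (h1 x).continuousAt
  have hη'c : Continuous η' := continuous_iff_continuousAt.2 fun x => (h2 x).continuousAt
  have hac := ha.isGlobalSolution.continuous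
  have ha'c := ha.isGlobalSolution.continuous_deriv
  set f₁ : ℝ → ℂ := fun t => η t * a t with hf₁
  set f₂ : ℝ → ℂ := fun t => z * (η t * a t) - (η'' t * a t + 2 * (η' t * a' t)) with hf₂
  have hf₁r : ∀ x ≥ x₀, f₁ x = a x := fun x hx => by simp [hf₁, hr x hx]
  have hf₂r : ∀ x ≥ x₀, f₂ x = z * a x := fun x hx => by simp [hf₂, hr x hx]
  have hzero : ∀ f : ℝ → ℂ, (∀ x ≤ x₀ - 3, f x = 0) →
      MemLp ((Iic (x₀ - 3)).indicator f) 2 volume := by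
    intro f hf
    rw [indicator_eq_zero'.2]
    · exact MemLp.zero'
    · exact disjoint_left.2 fun x hx hx' => hx (hf x hx')
  have hm₁ : MemLp f₁ 2 volume := by
    refine memLp_of_memLp_indicator (by fun_prop) (hzero _ fun x hx => by simp [hf₁, hl x hx])
      (b := x₀) ?_
    rw [indicator_congr (s := Ici x₀) hf₁r]
    exact ha.memLp
  have hm₂ : MemLp f₂ 2 volume := by
    refine memLp_of_memLp_indicator (by fun_prop) (hzero _ fun x hx => by simp [hf₂, hl x hx])
      (b := x₀) ?_
    rw [indicator_congr (s := Ici x₀) hf₂r]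
    exact (ha.const_smul z).memLp
  have hmem' : (hm₁.toLp f₁, hm₂.toLp f₂) ∈ (schrodingerOp q).graph :=
    mem_graph_schrodingerOp_iff.2 ⟨_, _, hm₁.coeFn_toLp, hcut.congr_ae hm₂.coeFn_toLp.symm⟩
  have hd₁ : hm₁.toLp f₁ - α ∈ l2On (Iio x₀) := by
    change ∀ᵐ x ∂(volume : Measure ℝ), x ∉ Iio x₀ → _
    filter_upwards [Lp.coeFn_sub (hm₁.toLp f₁) α, hm₁.coeFn_toLp, ha.ae_eq] with x e1 e2 e3 hx
    have hx' : x ∈ Ici x₀ := not_lt.1 (mt mem_Iio.2 hx)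
    rw [e1, Pi.sub_apply, e2, e3, indicator_of_mem hx', hf₁r x hx', sub_self]
  have hd₂ : hm₂.toLp f₂ - z • α ∈ l2On (Iio x₀) := by
    change ∀ᵐ x ∂(volume : Measure ℝ), x ∉ Iio x₀ → _
    filter_upwards [Lp.coeFn_sub (hm₂.toLp f₂) (z • α), hm₂.coeFn_toLp,
      (ha.const_smul z).ae_eq] with x e1 e2 e3 hx
    have hx' : x ∈ Ici x₀ := not_lt.1 (mt mem_Iio.2 hx)
    rw [e1, Pi.sub_apply, e2, e3, indicator_of_mem hx', hf₂r x hx', sub_self]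
  have hvol : volume (Ici x₀ ∩ Iio x₀) = 0 := by
    rw [show Ici x₀ ∩ Iio x₀ = ∅ from by
      ext x; simp]
    exact measure_empty
  -- The part of the cutoff to the left of `x₀` is invisible to functions supported on `[x₀, ∞)`.
  have horth : ∀ g ∈ l2On (Ici x₀), inner ℂ g (hm₁.toLp f₁) = inner ℂ g α ∧
      inner ℂ g (hm₂.toLp f₂) = z * inner ℂ g α := by
    intro g hg
    have e1 := inner_eq_zero_of_mem_l2On hvol hg hd₁
    have e2 := inner_eq_zero_of_mem_l2On hvol hg hd₂
    rw [inner_sub_right, sub_eq_zero] at e1 e2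
    exact ⟨e1, by rw [e2, inner_smul_right]⟩
  have hα := horth α (mem_l2On_of_ae_eq_indicator ha.ae_eq)
  have hβ := horth β (mem_l2On_of_ae_eq_indicator hb.ae_eq)
  have hsym := symmetric_graph hL hmem hmem'
  simp only [inner_sub_left, inner_smul_left, hα.1, hα.2, hβ.1, hβ.2, hz', Complex.conj_conj]
    at hsym
  -- The terms with `⟨β, α⟩` cancel, both carrying the factor `z`, because `β` belongs to the
  -- conjugate point.
  have : (z - conj z) * inner ℂ α α = 0 := by linear_combination -hsym
  exact inner_self_eq_zero.1 ((mul_eq_zero.1 this).resolve_left (sub_conj_ne_zero hz))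

theorem IsTail.det_ne_zero (hq : LocallyIntegrable q volume)
    (hL : IsSelfAdjoint (schrodingerOp q)) {z z' : ℂ} (hz : z.im ≠ 0)
    (hz' : z' = conj z) {x₀ : ℝ} {e e' b b' : ℝ → ℂ} {e₀ b₀ : L2}
    (he : IsTail q z (Ici x₀) e e' e₀) (hb : IsTail q z' (Ici x₀) b b' b₀) (he₀ : ‖e₀‖ = 1)
    (hb₀ : ‖b₀‖ = 1) : e x₀ * b' x₀ - e' x₀ * b x₀ ≠ 0 := by
  intro hD
  have key : ∀ s t : ℂ, s * e x₀ = t * b x₀ → s * e' x₀ = t * b' x₀ → s = 0 ∧ t = 0 := by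
    intro s t h1 h2
    have e1 := (he.const_smul s).eq_zero_of_eq hL hz hz' (hb.const_smul t) h1 h2
    have e2 := (hb.const_smul t).eq_zero_of_eq hL (by rw [hz']; simpa using hz)
      (by rw [hz', Complex.conj_conj]) (he.const_smul s) h1.symm h2.symm
    constructor
    · simpa [norm_smul, he₀] using congrArg norm e1
    · simpa [norm_smul, hb₀] using congrArg norm e2
  -- A vanishing determinant makes the data of `e` and `b` proportional. These two choices of
  -- coefficients give `e x₀ = 0` and `e' x₀ = 0` without distinguishing cases.
  obtain ⟨-, h0⟩ := key (b x₀) (e x₀) (mul_comm _ _) (by linear_combination -hD)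
  obtain ⟨-, h0'⟩ := key (b' x₀) (e' x₀) (by linear_combination hD) (mul_comm _ _)
  refine he.ne_zero he₀ (he.isGlobalSolution.ext hq (p := x₀) (φ' := 0) (v' := 0) ?_ h0 h0').1
  exact IsForcedSolution.zero.congr_fun (fun t => by simp) (fun _ => rfl) fun _ => rfl

/-- Continuity upgrades equality almost everywhere on `U` to equality on its closure; unique
differentiability then makes the one-sided derivatives at a boundary point agree. Cauchy data at `0`
and `x₀` are read off from the half-lines in this way. -/
theorem eq_and_eq_of_ae_eq_on {φ v ψ w : ℝ → ℂ} (hφ : ∀ x, HasDerivAt φ (v x) x)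
    (hψ : ∀ x, HasDerivAt ψ (w x) x) {U : Set ℝ} (hU : IsOpen U) {p : ℝ} (hp : p ∈ closure U)
    (hd : UniqueDiffWithinAt ℝ (closure U) p)
    (h : ∀ᵐ x ∂(volume : Measure ℝ), x ∈ U → φ x = ψ x) : φ p = ψ p ∧ v p = w p := by
  have hφc : Continuous φ := continuous_iff_continuousAt.2 fun x => (hφ x).continuousAt
  have hψc : Continuous ψ := continuous_iff_continuousAt.2 fun x => (hψ x).continuousAt
  have h1 : EqOn φ ψ U := Measure.eqOn_open_of_ae_eq
    ((ae_restrict_iff' hU.measurableSet).2 h) hU hφc.continuousOn hψc.continuousOn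
  have h2 : EqOn φ ψ (closure U) := h1.closure hφc hψc
  refine ⟨h2 hp, hd.eq_deriv _ (hφ p).hasDerivWithinAt ?_⟩
  exact (hψ p).hasDerivWithinAt.congr h2 (h2 hp)

/-- The Cayley transform on `L²[0,x₀] ⊕ E₁`: matching of Cauchy data at `0` and `x₀`. -/
theorem exists_cayley_eq_iff (hq : LocallyIntegrable q volume)
    (hL : IsSelfAdjoint (schrodingerOp q)) {z z' : ℂ} (hz : z.im ≠ 0) (hz' : z' = conj z) {x₀ : ℝ}
    (hx₀ : 0 < x₀) {m m' n n' e e' b b' : ℝ → ℂ} {m₀ n₀ e₀ b₀ : L2}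
    (hm : IsTail q z (Iic 0) m m' m₀) (hn : IsTail q z' (Iic 0) n n' n₀)
    (he : IsTail q z (Ici x₀) e e' e₀) (hb : IsTail q z' (Ici x₀) b b' b₀)
    (w c₀ c₁ d₀ d₁ : ℂ) :
    (∃ k ∈ l2On (Icc 0 x₀), cayley (schrodingerOp q) z ((w - z) • k + c₀ • n₀ + d₁ • b₀) =
      (w - z') • k + d₀ • e₀ + c₁ • m₀) ↔
    (fundamentalMatrix q w x₀).mulVec ![c₁ * m 0 - c₀ * n 0, c₁ * m' 0 - c₀ * n' 0] =
      ![d₀ * e x₀ - d₁ * b x₀, d₀ * e' x₀ - d₁ * b' x₀] := by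
  have hδ : z - z' ≠ 0 := hz' ▸ sub_conj_ne_zero hz
  have hne : ∀ a : ℝ, ∀ᵐ x ∂(volume : Measure ℝ), x ≠ a := fun a => Measure.ae_ne volume a
  -- The domain element behind `f ↦ g` is `δ (g - f)`; `δ` is kept abstract so that only `δ (z - z')
  -- = 1` is used.
  obtain ⟨δ, hδe⟩ : ∃ δ, δ = (z - z')⁻¹ := ⟨_, rfl⟩
  have hδ0 : δ ≠ 0 := hδe ▸ inv_ne_zero hδ
  have hδ1 : δ * (z - z') = 1 := by rw [hδe, inv_mul_cancel₀ hδ]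
  -- the solutions on the two half-lines that the domain element has to agree with
  have hℓ := (hm.isGlobalSolution.const_mul (δ * c₁)).add
    (hn.isGlobalSolution.const_mul (-(δ * c₀)))
  have hρ := (he.isGlobalSolution.const_mul (δ * d₀)).add
    (hb.isGlobalSolution.const_mul (-(δ * d₁)))
  have hcoe : ∀ k : L2, ∀ᵐ x ∂(volume : Measure ℝ),
      (((w - z) • k + c₀ • n₀ + d₁ • b₀ : L2) x = (w - z) * k x +
        c₀ * (Iic 0).indicator n x + d₁ * (Ici x₀).indicator b x) ∧
      (((w - z') • k + d₀ • e₀ + c₁ • m₀ : L2) x = (w - z') * k x +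
        d₀ * (Ici x₀).indicator e x + c₁ * (Iic 0).indicator m x) := by
    intro k
    filter_upwards [Lp.coeFn_add ((w - z) • k + c₀ • n₀) (d₁ • b₀),
      Lp.coeFn_add ((w - z) • k) (c₀ • n₀), Lp.coeFn_smul (w - z) k, Lp.coeFn_smul c₀ n₀,
      Lp.coeFn_smul d₁ b₀, Lp.coeFn_add ((w - z') • k + d₀ • e₀) (c₁ • m₀),
      Lp.coeFn_add ((w - z') • k) (d₀ • e₀), Lp.coeFn_smul (w - z') k, Lp.coeFn_smul d₀ e₀,
      Lp.coeFn_smul c₁ m₀, hm.ae_eq, hn.ae_eq, he.ae_eq, hb.ae_eq] with x a1 a2 a3 a4 a5 a6 a7 a8 a9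
      a10 a11 a12 a13 a14
    constructor
    · rw [a1, Pi.add_apply, a2, Pi.add_apply, a3, a4, a5, Pi.smul_apply, Pi.smul_apply,
        Pi.smul_apply, a12, a14, smul_eq_mul, smul_eq_mul, smul_eq_mul]
    · rw [a6, Pi.add_apply, a7, Pi.add_apply, a8, a9, a10, Pi.smul_apply, Pi.smul_apply,
        Pi.smul_apply, a11, a13, smul_eq_mul, smul_eq_mul, smul_eq_mul]
  -- the values of the domain element and of its image on the three intervals
  have hval : ∀ k ∈ l2On (Icc 0 x₀), ∀ f g : L2, f = (w - z) • k + c₀ • n₀ + d₁ • b₀ →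
      g = (w - z') • k + d₀ • e₀ + c₁ • m₀ → ∀ᵐ x ∂(volume : Measure ℝ),
      (x < 0 → (δ • (g - f) : L2) x = δ * c₁ * m x + -(δ * c₀) * n x ∧
        (f + z • δ • (g - f) : L2) x = δ * c₁ * (z * m x) + -(δ * c₀) * (z' * n x)) ∧
      (0 < x → x < x₀ → (δ • (g - f) : L2) x = k x ∧ (f + z • δ • (g - f) : L2) x = w * k x) ∧
      (x₀ < x → (δ • (g - f) : L2) x = δ * d₀ * e x + -(δ * d₁) * b x ∧
        (f + z • δ • (g - f) : L2) x = δ * d₀ * (z * e x) + -(δ * d₁) * (z' * b x)) := by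
    intro k hk f g hf hg
    have hk' : ∀ᵐ x ∂(volume : Measure ℝ), x ∉ Icc 0 x₀ → k x = 0 := hk
    filter_upwards [hk', hcoe k, Lp.coeFn_add f (z • δ • (g - f)),
      Lp.coeFn_smul z (δ • (g - f)), Lp.coeFn_smul δ (g - f), Lp.coeFn_sub g f]
      with x h1 h2 h3 h4 h5 h6
    rw [← hf, ← hg] at h2
    rw [h3, Pi.add_apply, h4, Pi.smul_apply, h5, Pi.smul_apply, h6, Pi.sub_apply, h2.1, h2.2,
      smul_eq_mul, smul_eq_mul]
    refine ⟨fun hx => ?_, fun hx hx' => ?_, fun hx => ?_⟩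
    · have i1 : x ∈ Iic 0 := hx.le
      have i2 : x ∉ Ici x₀ := not_le.2 (hx.trans hx₀)
      rw [h1 fun h => absurd h.1 (not_le.2 hx)]
      simp only [indicator_of_mem i1, indicator_of_notMem i2]
      exact ⟨by ring, by linear_combination (-c₀ * n x) * hδ1⟩
    · have i1 : x ∉ Iic 0 := not_le.2 hx
      have i2 : x ∉ Ici x₀ := not_le.2 hx'
      simp only [indicator_of_notMem i1, indicator_of_notMem i2]
      exact ⟨by linear_combination k x * hδ1, by linear_combination z * k x * hδ1⟩
    · have i1 : x ∉ Iic 0 := not_le.2 (hx₀.trans hx)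
      have i2 : x ∈ Ici x₀ := hx.le
      rw [h1 fun h => absurd h.2 (not_le.2 hx)]
      simp only [indicator_of_mem i2, indicator_of_notMem i1]
      exact ⟨by ring, by linear_combination (-d₁ * b x) * hδ1⟩
  constructor
  · rintro ⟨k, hk, hkc⟩
    have hv := hval k hk _ _ rfl rfl
    rw [cayley_eq_iff hL hz, ← hz', ← hδe] at hkc
    obtain ⟨φ, v, hyφ, hφ⟩ := mem_graph_schrodingerOp_iff.1 hkc
    have h0 := eq_and_eq_of_ae_eq_on hφ.hasDerivAt hℓ.hasDerivAt (U := Iio 0) isOpen_Iio (p := 0)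
      (by rw [closure_Iio]; exact mem_Iic.2 le_rfl)
      (by rw [closure_Iio]; exact uniqueDiffOn_Iic 0 _ (mem_Iic.2 le_rfl)) (by
        filter_upwards [hv, hyφ] with x h1 h2 hx
        rw [← h2, (h1.1 hx).1])
    have h1 := eq_and_eq_of_ae_eq_on hφ.hasDerivAt hρ.hasDerivAt (U := Ioi x₀) isOpen_Ioi (p := x₀)
      (by rw [closure_Ioi]; exact mem_Ici.2 le_rfl)
      (by rw [closure_Ioi]; exact uniqueDiffOn_Ici x₀ _ (mem_Ici.2 le_rfl)) (by
        filter_upwards [hv, hyφ] with x h1 h2 hx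
        rw [← h2, (h1.2.2 hx).1])
    -- Between `0` and `x₀` the domain element is `k` and its image under `L` is `w k`, so the
    -- equation holds there at the spectral parameter `w`.
    have hs : SolvesBetween q w 0 x₀ φ v := hφ.solvesBetween (by
      filter_upwards [hv, hyφ, hne 0, hne x₀] with x h1 h2 h3 h4 hx
      rw [uIcc_of_le hx₀.le] at hx
      obtain ⟨h5, h6⟩ := h1.2.1 (lt_of_le_of_ne hx.1 (Ne.symm h3)) (lt_of_le_of_ne hx.2 h4)
      rw [h6, ← h2, h5])
    have hB := fundamentalMatrix_mulVec hq hs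
    have e1 : (![φ 0, v 0] : Fin 2 → ℂ) = δ • ![c₁ * m 0 - c₀ * n 0, c₁ * m' 0 - c₀ * n' 0] := by
      rw [h0.1, h0.2]
      ext i
      fin_cases i <;> simp <;> ring
    have e2 : (![φ x₀, v x₀] : Fin 2 → ℂ) =
        δ • ![d₀ * e x₀ - d₁ * b x₀, d₀ * e' x₀ - d₁ * b' x₀] := by
      rw [h1.1, h1.2]
      ext i
      fin_cases i <;> simp <;> ring
    rw [e1, e2, Matrix.mulVec_smul] at hB
    exact smul_right_injective _ hδ0 hB
  · intro hB
    -- Conversely, `k` has to be the solution at `w` that continues the left piece across `0`; the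
    -- matrix identity then says that it meets the right piece at `x₀`.
    obtain ⟨κ, κ', hκ, h0, h0'⟩ := exists_isGlobalSolution hq w 0
      (δ * c₁ * m 0 + -(δ * c₀) * n 0) (δ * c₁ * m' 0 + -(δ * c₀) * n' 0)
    have hB' := fundamentalMatrix_mulVec hq (hκ.solvesBetween (z := w) (p := 0) (x := x₀) (by simp))
    have e1 : (![κ 0, κ' 0] : Fin 2 → ℂ) = δ • ![c₁ * m 0 - c₀ * n 0, c₁ * m' 0 - c₀ * n' 0] := by
      rw [h0, h0']
      ext i
      fin_cases i <;> simp <;> ring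
    rw [e1, Matrix.mulVec_smul, hB] at hB'
    have h1 : κ x₀ = δ * d₀ * e x₀ + -(δ * d₁) * b x₀ := by
      have := congrFun hB' 0
      simp at this
      rw [← this]
      ring
    have h1' : κ' x₀ = δ * d₀ * e' x₀ + -(δ * d₁) * b' x₀ := by
      have := congrFun hB' 1
      simp at this
      rw [← this]
      ring
    -- At `x₀` the function glued first takes the values of `κ`, since `x₀ > 0`.
    have hg := (hℓ.glue hκ (p := 0) h0.symm h0'.symm).glue hρ (p := x₀)
      (by simpa [not_le.2 hx₀] using h1) (by simpa [not_le.2 hx₀] using h1')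
    have hκL := memLp_indicator_Icc hκ.continuous 0 x₀
    have hk := mem_l2On_of_ae_eq_indicator hκL.coeFn_toLp
    have hv := hval _ hk _ _ rfl rfl
    refine ⟨hκL.toLp _, hk, ?_⟩
    rw [cayley_eq_iff hL hz, ← hz', ← hδe]
    have hcases : ∀ᵐ x ∂(volume : Measure ℝ), x < 0 ∨ (0 < x ∧ x < x₀) ∨ x₀ < x := by
      filter_upwards [hne 0, hne x₀] with x a1 a2
      rcases lt_or_gt_of_ne a1 with h | h
      · exact Or.inl h
      · rcases lt_or_gt_of_ne a2 with h' | h'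
        · exact Or.inr (Or.inl ⟨h, h'⟩)
        · exact Or.inr (Or.inr h')
    refine mem_graph_schrodingerOp_iff.2 ⟨_, _, ?_, hg.congr_ae ?_⟩
    · filter_upwards [hv, hcases, hκL.coeFn_toLp] with x a1 a2 a3
      rcases a2 with h | ⟨h, h'⟩ | h
      · rw [(a1.1 h).1, if_pos (h.trans hx₀).le, if_pos h.le]
      · rw [(a1.2.1 h h').1, a3, if_pos h'.le, if_neg (not_le.2 h),
          indicator_of_mem (show x ∈ Icc 0 x₀ from ⟨h.le, h'.le⟩)]
      · rw [(a1.2.2 h).1, if_neg (not_le.2 h)]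
    · filter_upwards [hv, hcases, hκL.coeFn_toLp] with x a1 a2 a3
      rcases a2 with h | ⟨h, h'⟩ | h
      · rw [(a1.1 h).2, if_pos (h.trans hx₀).le, if_pos h.le]
      · rw [(a1.2.1 h h').2, a3, if_pos h'.le, if_neg (not_le.2 h),
          indicator_of_mem (show x ∈ Icc 0 x₀ from ⟨h.le, h'.le⟩)]
      · rw [(a1.2.2 h).2, if_neg (not_le.2 h)]

end Matching

/-! ### Unitary nodes and their transfer matrices. -/

section AbstractNode

variable {H : Type*} [NormedAddCommGroup H] [InnerProductSpace ℂ H]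

theorem exists_orthonormalBasis_span_pair {a b : H} (ha : ‖a‖ = 1) (hb : ‖b‖ = 1)
    (hab : inner ℂ a b = 0) : ∃ B : OrthonormalBasis (Fin 2) ℂ (Submodule.span ℂ {a, b}),
      (B 0 : H) = a ∧ (B 1 : H) = b := by
  have ho : Orthonormal ℂ ![a, b] := by
    rw [orthonormal_iff_ite]
    have hba : inner ℂ b a = 0 := inner_eq_zero_symm.1 hab
    intro i j
    fin_cases i <;> fin_cases j <;>
      simp [ha, hb, hab, hba, inner_self_eq_norm_sq_to_K]
  rw [← Matrix.range_cons_cons_empty a b ![]]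
  let B₀ := Module.Basis.span ho.linearIndependent
  have hB₀ : ∀ i, (B₀ i : H) = ![a, b] i := fun i =>
    congrArg Subtype.val (Module.Basis.span_apply _ i)
  have hB : Orthonormal ℂ B₀ := by
    rw [orthonormal_iff_ite] at ho ⊢
    intro i j
    rw [← ho i j, ← hB₀, ← hB₀]
    rfl
  refine ⟨B₀.toOrthonormalBasis hB, ?_, ?_⟩
  · rw [Module.Basis.coe_toOrthonormalBasis]
    exact hB₀ 0
  · rw [Module.Basis.coe_toOrthonormalBasis]
    exact hB₀ 1

/-- A unitary operator that maps `K ⊕ E₁` onto `K ⊕ E₂` cuts out a unitary node. -/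
theorem exists_unitaryNode [CompleteSpace H] (u : H ≃ₗᵢ[ℂ] H) {K : Submodule ℂ H}
    (hK : IsClosed (K : Set H)) {a₁ a₂ b₁ b₂ : H} (ha₁ : ‖a₁‖ = 1) (ha₂ : ‖a₂‖ = 1)
    (hb₁ : ‖b₁‖ = 1) (hb₂ : ‖b₂‖ = 1) (ha : inner ℂ a₁ a₂ = 0) (hb : inner ℂ b₁ b₂ = 0)
    (h₁ : K ⟂ Submodule.span ℂ {a₁, a₂}) (h₂ : K ⟂ Submodule.span ℂ {b₁, b₂})
    (h : (K ⊔ Submodule.span ℂ {a₁, a₂}).map (u.toLinearEquiv : H →ₗ[ℂ] H) =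
      K ⊔ Submodule.span ℂ {b₁, b₂}) :
    ∃ (N : UnitaryNode H) (B₁ : OrthonormalBasis (Fin 2) ℂ N.E₁)
      (B₂ : OrthonormalBasis (Fin 2) ℂ N.E₂), N.K = K ∧ (B₁ 0 : H) = a₁ ∧ (B₁ 1 : H) = a₂ ∧
      (B₂ 0 : H) = b₁ ∧ (B₂ 1 : H) = b₂ ∧ ∀ f : ↥(N.K ⊔ N.E₁), (N.U f : H) = u f := by
  obtain ⟨B₁, hB₁, hB₁'⟩ := exists_orthonormalBasis_span_pair ha₁ ha₂ ha
  obtain ⟨B₂, hB₂, hB₂'⟩ := exists_orthonormalBasis_span_pair hb₁ hb₂ hb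
  have : CompleteSpace K := hK.completeSpace_coe
  have f₁ : FiniteDimensional ℂ (Submodule.span ℂ {a₁, a₂}) :=
    FiniteDimensional.span_of_finite ℂ (by simp)
  have f₂ : FiniteDimensional ℂ (Submodule.span ℂ {b₁, b₂}) :=
    FiniteDimensional.span_of_finite ℂ (by simp)
  exact ⟨{ K := K
           E₁ := Submodule.span ℂ {a₁, a₂}
           E₂ := Submodule.span ℂ {b₁, b₂}
           orth₁ := h₁
           orth₂ := h₂
           U := (u.submoduleMap _).trans (LinearIsometryEquiv.ofEq _ _ h) },
    B₁, B₂, rfl, hB₁, hB₁', hB₂, hB₂', fun f => rfl⟩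

namespace UnitaryNode

/-- A Neumann series: `ζ P_K U` has norm at most `‖ζ‖`. The space `K ⊕ E₁` is complete because `K`
is closed and `E₁` is finite-dimensional. -/
theorem isUnit_pencil [CompleteSpace H] (N : UnitaryNode H) (hK : IsClosed (N.K : Set H)) {ζ : ℂ}
    (hζ : ‖ζ‖ < 1) : IsUnit (N.pencil ζ) := by
  have hc : IsClosed ((N.K ⊔ N.E₁ : Submodule ℂ H) : Set H) :=
    Submodule.isClosed_sup_finiteDimensional _ _ hK
  have : CompleteSpace ↥(N.K ⊔ N.E₁) := hc.completeSpace_coe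
  refine isUnit_one_sub_of_norm_lt_one (x := ζ • N.compressed) (lt_of_le_of_lt ?_ hζ)
  refine ContinuousLinearMap.opNorm_le_bound _ (norm_nonneg ζ) fun f => ?_
  change ‖ζ • N.K.starProjection (N.U f : H)‖ ≤ ‖ζ‖ * ‖f‖
  rw [norm_smul, ← N.U.norm_map f]
  exact mul_le_mul_of_nonneg_left (N.K.norm_starProjection_apply_le _) (norm_nonneg ζ)

/-- The system equations of the node: `Θ(ζ) e` is the output to the input `e`. -/
theorem exists_map_eq_add_charFun (N : UnitaryNode H) {ζ : ℂ} (hζ : IsUnit (N.pencil ζ))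
    (e : N.E₁) : ∃ k ∈ N.K, ∃ h : ↥(N.K ⊔ N.E₁), (h : H) = ζ • k + e ∧
      (N.U h : H) = k + N.charFun ζ e := by
  set e' : ↥(N.K ⊔ N.E₁) := Submodule.inclusion le_sup_right e with he'
  set P : Module.End ℂ ↥(N.K ⊔ N.E₁) := (N.pencil ζ : ↥(N.K ⊔ N.E₁) →ₗ[ℂ] ↥(N.K ⊔ N.E₁)) with hP
  -- `charFun` inverts the pencil among all linear endomorphisms, so invertibility as a bounded
  -- operator is first transported there.
  have hPu : IsUnit P := hζ.map ContinuousLinearMap.toLinearMapRingHom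
  set h := Ring.inverse P e' with hh
  have h1 : N.pencil ζ h = e' := by
    exact LinearMap.congr_fun (Ring.mul_inverse_cancel _ hPu) e'
  have h2 : (h : H) - ζ • N.K.starProjection (N.U h : H) = e := congrArg Subtype.val h1
  -- As `K ⟂ E₂`, the components of `U h` are its two projections: `k = P_K U h` is the state and
  -- `w` is the output.
  obtain ⟨k, hk, w, hw, hkw⟩ := Submodule.mem_sup.1 (N.U h).2
  have hkp : N.K.starProjection (N.U h : H) = k := by
    rw [← hkw, map_add, Submodule.starProjection_eq_self_iff.2 hk,
      (Submodule.starProjection_apply_eq_zero_iff _).2 (N.orth₂.symm hw), add_zero]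
  have hwp : (N.charFun ζ e : H) = w := by
    have : N.charFun ζ e = N.E₂.orthogonalProjectionOnto (N.U h : H) := by
      simp only [charFun, LinearMap.comp_apply]
      rfl
    rw [this, ← hkw, map_add,
      Submodule.orthogonalProjectionOnto_apply_of_mem_orthogonal (N.orth₂ hk), zero_add]
    exact Submodule.starProjection_eq_self_iff.2 hw
  refine ⟨k, hk, h, ?_, ?_⟩
  · rw [← h2, hkp]
    abel
  · rw [hwp, hkw]

theorem charFun_apply_eq (N : UnitaryNode H) (b₁ : OrthonormalBasis (Fin 2) ℂ N.E₁)
    (b₂ : OrthonormalBasis (Fin 2) ℂ N.E₂) (ζ c d : ℂ) :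
    N.charFun ζ (c • b₁ 0 + d • b₁ 1) =
      (N.charMatrix b₁ b₂ ζ 0 0 * c + N.charMatrix b₁ b₂ ζ 0 1 * d) • b₂ 0 +
      (N.charMatrix b₁ b₂ ζ 1 0 * c + N.charMatrix b₁ b₂ ζ 1 1 * d) • b₂ 1 := by
  have h : ∀ j, N.charFun ζ (b₁ j) =
      N.charMatrix b₁ b₂ ζ 0 j • b₂ 0 + N.charMatrix b₁ b₂ ζ 1 j • b₂ 1 := by
    intro j
    have := b₂.toBasis.sum_repr (N.charFun ζ (b₁ j))
    rw [Fin.sum_univ_two] at this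
    rw [← this]
    simp [charMatrix, LinearMap.toMatrix_apply]
  rw [map_add, map_smul, map_smul, h, h]
  module

/-- If the output and the input at the first channel depend on the input and the output at the
second one through the matrix `M`, then `M` is the transfer matrix. -/
theorem transferMatrix_eq_of_forall (N : UnitaryNode H) (b₁ : OrthonormalBasis (Fin 2) ℂ N.E₁)
    (b₂ : OrthonormalBasis (Fin 2) ℂ N.E₂) (ζ : ℂ) {M : Matrix (Fin 2) (Fin 2) ℂ}
    (h : ∀ c d, ![N.charMatrix b₁ b₂ ζ 0 0 * c + N.charMatrix b₁ b₂ ζ 0 1 * d, d] =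
      M.mulVec ![c, N.charMatrix b₁ b₂ ζ 1 0 * c + N.charMatrix b₁ b₂ ζ 1 1 * d]) :
    N.charMatrix b₁ b₂ ζ 1 1 ≠ 0 ∧ N.transferMatrix b₁ b₂ ζ = M := by
  unfold transferMatrix
  generalize N.charMatrix b₁ b₂ ζ = θ at h ⊢
  -- If this entry were zero, the input `(0, 1)` would make `M` applied to the zero vector have
  -- second entry `1`.
  have hθ : θ 1 1 ≠ 0 := by
    intro h0
    have := congrFun (h 0 1) 1
    simp [h0, Matrix.mulVec, dotProduct, Fin.sum_univ_two] at this
  have hXY : !![θ 0 0, θ 0 1; 0, 1] = M * !![1, 0; θ 1 0, θ 1 1] := by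
    have h10 := h 1 0
    have h01 := h 0 1
    ext i j
    have e10 := congrFun h10 i
    have e01 := congrFun h01 i
    fin_cases i <;> fin_cases j <;>
      simp [Matrix.mulVec, dotProduct, Fin.sum_univ_two, Matrix.mul_apply] at e10 e01 ⊢ <;>
      assumption
  refine ⟨hθ, ?_⟩
  rw [hXY, Matrix.mul_nonsing_inv_cancel_right]
  rw [Matrix.det_fin_two_of]
  simpa using hθ

end UnitaryNode

end AbstractNode

/-! ### Spectral variable, matrix algebra and null intersections. -/

theorem norm_spectralVar_lt_one {lam₀ lam : ℂ} (h₀ : 0 < (lam₀ ^ 2).im) (h : 0 < (lam ^ 2).im) :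
    ‖spectralVar lam₀ lam‖ < 1 := by
  have hr : lam ^ 2 - conj lam₀ ^ 2 ≠ 0 := by
    intro h'
    have := congrArg Complex.im h'
    rw [← map_pow, Complex.sub_im, Complex.conj_im, Complex.zero_im] at this
    linarith
  rw [spectralVar, norm_div, div_lt_one (norm_pos_iff.2 hr), ← map_pow,
    ← sq_lt_sq₀ (norm_nonneg _) (norm_nonneg _), Complex.sq_norm, Complex.sq_norm,
    Complex.normSq_apply, Complex.normSq_apply]
  simp only [Complex.sub_re, Complex.sub_im, Complex.conj_re, Complex.conj_im]
  -- `|w - z̄|² - |w - z|² = 4 Im w Im z`, with `w = λ²` and `z = λ₀²`.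
  nlinarith [mul_pos h₀ h]

theorem eq_inv_mul_mul_mulVec_iff {P B Q : Matrix (Fin 2) (Fin 2) ℂ} (hP : IsUnit P.det)
    (c d : Fin 2 → ℂ) :
    d = (P⁻¹ * B * Q).mulVec c ↔ B.mulVec (Q.mulVec c) = P.mulVec d := by
  rw [mul_assoc, ← Matrix.mulVec_mulVec c P⁻¹, Matrix.mulVec_mulVec c B]
  generalize (B * Q).mulVec c = x
  constructor
  · rintro rfl
    rw [Matrix.mulVec_mulVec, Matrix.mul_nonsing_inv _ hP, Matrix.one_mulVec]
  · rintro rfl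
    rw [Matrix.mulVec_mulVec, Matrix.nonsing_inv_mul _ hP, Matrix.one_mulVec]

theorem isOrtho_l2On_span_pair {I J J' : Set ℝ} (h : volume (I ∩ J) = 0) (h' : volume (I ∩ J') = 0)
    {a b : L2} (ha : a ∈ l2On J) (hb : b ∈ l2On J') :
    l2On I ⟂ Submodule.span ℂ {a, b} := by
  rw [Submodule.isOrtho_iff_inner_eq]
  intro f hf g hg
  obtain ⟨c, d, rfl⟩ := Submodule.mem_span_pair.1 hg
  rw [inner_add_right, inner_smul_right, inner_smul_right, inner_eq_zero_of_mem_l2On h hf ha,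
    inner_eq_zero_of_mem_l2On h' hf hb, mul_zero, mul_zero, add_zero]

theorem volume_Icc_inter_Iic (x₀ : ℝ) : volume (Icc 0 x₀ ∩ Iic 0) = 0 :=
  measure_mono_null (fun _ hx => mem_singleton_iff.2 (le_antisymm hx.2 hx.1.1))
    (measure_singleton (0 : ℝ))

theorem volume_Icc_inter_Ici (x₀ : ℝ) : volume (Icc 0 x₀ ∩ Ici x₀) = 0 :=
  measure_mono_null (fun _ hx => mem_singleton_iff.2 (le_antisymm hx.1.2 hx.2))
    (measure_singleton x₀)

theorem volume_Iic_inter_Ici {x₀ : ℝ} (hx₀ : 0 < x₀) : volume (Iic 0 ∩ Ici x₀) = 0 := by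
  rw [show Iic 0 ∩ Ici x₀ = ∅ from eq_empty_of_forall_notMem fun x hx =>
    absurd (le_trans hx.2 hx.1) (not_le.2 hx₀)]
  exact measure_empty

end SchrodingerNode

/-! ### The main theorem. -/

theorem mainTheorem9 (q : ℝ → ℝ) (hq : LocallyIntegrable q (volume : Measure ℝ))
    (hL : IsSelfAdjoint (SchrodingerNode.schrodingerOp q))
    (lam₀ : ℂ) (hre : 0 < lam₀.re) (him : 0 < lam₀.im) (x₀ : ℝ) (hx₀ : 0 < x₀)
    (eMinus ePlus : ℂ → ℝ → ℂ)
    (hMinus : ∀ μ ∈ ({lam₀, -conj lam₀} : Set ℂ),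
      SchrodingerNode.IsNormalizedSolution q (μ ^ 2) (Iic 0) (eMinus μ))
    (hPlus : ∀ μ ∈ ({lam₀, -conj lam₀} : Set ℂ),
      SchrodingerNode.IsNormalizedSolution q (μ ^ 2) (Ici x₀) (ePlus μ)) :
    -- the resolvent at `λ₀²` is everywhere defined and single-valued
    (∀ f : SchrodingerNode.L2, ∃! y : (SchrodingerNode.schrodingerOp q).domain,
      SchrodingerNode.schrodingerOp q y - lam₀ ^ 2 • (y : SchrodingerNode.L2) = f) ∧
    -- the Cayley transform is unitary on `L²(ℝ)`
    (∃ u : SchrodingerNode.L2 ≃ₗᵢ[ℂ] SchrodingerNode.L2,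
      ∀ f, u f = SchrodingerNode.cayley (SchrodingerNode.schrodingerOp q) (lam₀ ^ 2) f) ∧
    -- the entries `c`, `s` of the fundamental matrix are the solutions of the Cauchy problems
    (∀ z : ℂ,
      SchrodingerNode.IsCauchySolution q z 1 0 (SchrodingerNode.cauchySolution q z 1 0) ∧
      SchrodingerNode.IsCauchySolution q z 0 1 (SchrodingerNode.cauchySolution q z 0 1)) ∧
    IsUnit (SchrodingerNode.plusMatrix lam₀ x₀ ePlus).det ∧
    -- the unitary node, which the following identities determine, and its transfer matrix
    (∃ (N : SchrodingerNode.UnitaryNode SchrodingerNode.L2)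
      (b₁ : OrthonormalBasis (Fin 2) ℂ N.E₁) (b₂ : OrthonormalBasis (Fin 2) ℂ N.E₂),
      N.K = SchrodingerNode.l2On (Icc 0 x₀) ∧
      (b₁ 0 : SchrodingerNode.L2) =
        SchrodingerNode.extendL2 (Iic 0) (eMinus (-conj lam₀)) ∧
      (b₁ 1 : SchrodingerNode.L2) =
        SchrodingerNode.extendL2 (Ici x₀) (ePlus (-conj lam₀)) ∧
      (b₂ 0 : SchrodingerNode.L2) = SchrodingerNode.extendL2 (Ici x₀) (ePlus lam₀) ∧
      (b₂ 1 : SchrodingerNode.L2) = SchrodingerNode.extendL2 (Iic 0) (eMinus lam₀) ∧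
      (∀ f : ↥(N.K ⊔ N.E₁), (N.U f : SchrodingerNode.L2) =
        SchrodingerNode.cayley (SchrodingerNode.schrodingerOp q) (lam₀ ^ 2) f) ∧
      (∀ ζ : ℂ, ‖ζ‖ < 1 → IsUnit (N.pencil ζ)) ∧
      (∀ lam : ℂ, 0 < (lam ^ 2).im → ‖SchrodingerNode.spectralVar lam₀ lam‖ < 1) ∧
      (∀ lam : ℂ, lam ^ 2 ≠ conj lam₀ ^ 2 →
        IsUnit (N.pencil (SchrodingerNode.spectralVar lam₀ lam)) →
        N.charMatrix b₁ b₂ (SchrodingerNode.spectralVar lam₀ lam) 1 1 ≠ 0 ∧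
        N.transferMatrix b₁ b₂ (SchrodingerNode.spectralVar lam₀ lam) =
          (SchrodingerNode.plusMatrix lam₀ x₀ ePlus)⁻¹ *
            SchrodingerNode.fundamentalMatrix q (lam ^ 2) x₀ *
            SchrodingerNode.minusMatrix lam₀ eMinus)) ∧
    -- for every `λ`, with `ζ = p / r`, `p = λ² - λ₀²`, `r = λ² - λ̄₀²` in homogeneous form:
    -- `u (p k + c₁ e⁻ + d₂ e⁺) = r k + d₁ e⁺ + c₂ e⁻` for some `k` exactly when `d = 𝔄(λ²) c`
    (∀ lam : ℂ, ∀ c d : Fin 2 → ℂ,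
      (∃ k ∈ SchrodingerNode.l2On (Icc 0 x₀),
        SchrodingerNode.cayley (SchrodingerNode.schrodingerOp q) (lam₀ ^ 2)
          ((lam ^ 2 - lam₀ ^ 2) • k +
            c 0 • SchrodingerNode.extendL2 (Iic 0) (eMinus (-conj lam₀)) +
            d 1 • SchrodingerNode.extendL2 (Ici x₀) (ePlus (-conj lam₀))) =
          (lam ^ 2 - conj lam₀ ^ 2) • k +
            d 0 • SchrodingerNode.extendL2 (Ici x₀) (ePlus lam₀) +
            c 1 • SchrodingerNode.extendL2 (Iic 0) (eMinus lam₀)) ↔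
      d = ((SchrodingerNode.plusMatrix lam₀ x₀ ePlus)⁻¹ *
            SchrodingerNode.fundamentalMatrix q (lam ^ 2) x₀ *
            SchrodingerNode.minusMatrix lam₀ eMinus).mulVec c) := by
  -- `Im λ₀² = 2 Re λ₀ Im λ₀`; this is where both positivity assumptions on `λ₀` are used.
  have hz : 0 < (lam₀ ^ 2).im := by
    rw [sq, Complex.mul_im]
    nlinarith [mul_pos hre him]
  have hz0 : (lam₀ ^ 2).im ≠ 0 := hz.ne'
  have hz' : (-conj lam₀) ^ 2 = conj (lam₀ ^ 2) := by rw [neg_sq, map_pow]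
  have hcsq : conj lam₀ ^ 2 = (-conj lam₀) ^ 2 := by rw [neg_sq]
  have hM := hMinus lam₀ (by simp)
  have hN := hMinus (-conj lam₀) (by simp)
  have hE := hPlus lam₀ (by simp)
  have hB := hPlus (-conj lam₀) (by simp)
  obtain ⟨m, m', hm, hm1, hm2⟩ := hM.exists_isTail hq (p := 0) (mem_Iic.2 le_rfl)
  obtain ⟨n, n', hn, hn1, hn2⟩ := hN.exists_isTail hq (p := 0) (mem_Iic.2 le_rfl)
  obtain ⟨e, e', he, he1, he2⟩ := hE.exists_isTail hq (p := x₀) (mem_Ici.2 le_rfl)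
  obtain ⟨b, b', hb, hb1, hb2⟩ := hB.exists_isTail hq (p := x₀) (mem_Ici.2 le_rfl)
  have nm := SchrodingerNode.norm_extendL2 measurableSet_Iic hM
  have nn := SchrodingerNode.norm_extendL2 measurableSet_Iic hN
  have ne := SchrodingerNode.norm_extendL2 measurableSet_Ici hE
  have nb := SchrodingerNode.norm_extendL2 measurableSet_Ici hB
  have om := SchrodingerNode.extendL2_mem_l2On hM
  have on := SchrodingerNode.extendL2_mem_l2On hN
  have oe := SchrodingerNode.extendL2_mem_l2On hE
  have ob := SchrodingerNode.extendL2_mem_l2On hB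
  have hP : IsUnit (SchrodingerNode.plusMatrix lam₀ x₀ ePlus).det := by
    rw [isUnit_iff_ne_zero, SchrodingerNode.plusMatrix, Matrix.det_fin_two_of, ← he1, ← he2, ← hb1,
      ← hb2]
    intro h
    exact he.det_ne_zero hq hL hz0 hz' hb ne nb (by linear_combination -h)
  -- the boundary form of the system equations
  have hiff : ∀ lam : ℂ, ∀ c d : Fin 2 → ℂ,
      (∃ k ∈ SchrodingerNode.l2On (Icc 0 x₀),
        SchrodingerNode.cayley (SchrodingerNode.schrodingerOp q) (lam₀ ^ 2)
          ((lam ^ 2 - lam₀ ^ 2) • k +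
            c 0 • SchrodingerNode.extendL2 (Iic 0) (eMinus (-conj lam₀)) +
            d 1 • SchrodingerNode.extendL2 (Ici x₀) (ePlus (-conj lam₀))) =
          (lam ^ 2 - conj lam₀ ^ 2) • k +
            d 0 • SchrodingerNode.extendL2 (Ici x₀) (ePlus lam₀) +
            c 1 • SchrodingerNode.extendL2 (Iic 0) (eMinus lam₀)) ↔
      d = ((SchrodingerNode.plusMatrix lam₀ x₀ ePlus)⁻¹ *
            SchrodingerNode.fundamentalMatrix q (lam ^ 2) x₀ *
            SchrodingerNode.minusMatrix lam₀ eMinus).mulVec c := by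
    intro lam c d
    rw [hcsq, SchrodingerNode.exists_cayley_eq_iff hq hL hz0 hz' hx₀ hm hn he hb,
      SchrodingerNode.eq_inv_mul_mul_mulVec_iff hP]
    have e1 : (SchrodingerNode.minusMatrix lam₀ eMinus).mulVec c =
        ![c 1 * m 0 - c 0 * n 0, c 1 * m' 0 - c 0 * n' 0] := by
      rw [hm1, hm2, hn1, hn2]
      ext i
      fin_cases i <;>
        simp [SchrodingerNode.minusMatrix, Matrix.mulVec, dotProduct, Fin.sum_univ_two] <;> ring
    have e2 : (SchrodingerNode.plusMatrix lam₀ x₀ ePlus).mulVec d =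
        ![d 0 * e x₀ - d 1 * b x₀, d 0 * e' x₀ - d 1 * b' x₀] := by
      rw [he1, he2, hb1, hb2]
      ext i
      fin_cases i <;>
        simp [SchrodingerNode.plusMatrix, Matrix.mulVec, dotProduct, Fin.sum_univ_two] <;> ring
    rw [e1, e2]
  obtain ⟨u, hu⟩ := SchrodingerNode.exists_linearIsometryEquiv_cayley hL hz0
  refine ⟨SchrodingerNode.existsUnique_sub_smul_eq hL hz0, ⟨u, hu⟩,
    fun z => ⟨SchrodingerNode.cauchySolution_spec hq z 1 0,
      SchrodingerNode.cauchySolution_spec hq z 0 1⟩, hP, ?_, hiff⟩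
  have hK := SchrodingerNode.isClosed_l2On (measurableSet_Icc (a := (0 : ℝ)) (b := x₀))
  have h₁ := SchrodingerNode.isOrtho_l2On_span_pair (SchrodingerNode.volume_Icc_inter_Iic x₀)
    (SchrodingerNode.volume_Icc_inter_Ici x₀) on ob
  have h₂ := SchrodingerNode.isOrtho_l2On_span_pair (SchrodingerNode.volume_Icc_inter_Ici x₀)
    (SchrodingerNode.volume_Icc_inter_Iic x₀) oe om
  have hmap : (SchrodingerNode.l2On (Icc 0 x₀) ⊔ Submodule.span ℂ
      {SchrodingerNode.extendL2 (Iic 0) (eMinus (-conj lam₀)),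
        SchrodingerNode.extendL2 (Ici x₀) (ePlus (-conj lam₀))}).map
      (u.toLinearEquiv : SchrodingerNode.L2 →ₗ[ℂ] SchrodingerNode.L2) =
      SchrodingerNode.l2On (Icc 0 x₀) ⊔ Submodule.span ℂ
        {SchrodingerNode.extendL2 (Ici x₀) (ePlus lam₀),
          SchrodingerNode.extendL2 (Iic 0) (eMinus lam₀)} := by
    rw [pair_comm (SchrodingerNode.extendL2 (Ici x₀) (ePlus lam₀))]
    refine le_antisymm ?_ fun g hg => ?_
    · rintro _ ⟨f, hf, rfl⟩
      change u f ∈ _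
      rw [hu]
      exact SchrodingerNode.cayley_mem_sup hq hL hz0 hz' hx₀ hm hn he hb (hm.ne_zero nm)
        (he.ne_zero ne) hf
    -- The preimage is given by the Cayley transform at the conjugate point, which maps `K ⊕ E₂`
    -- into `K ⊕ E₁` by the same lemma with the solutions at `λ₀` and `-λ̄₀` interchanged.
    · refine ⟨SchrodingerNode.cayley (SchrodingerNode.schrodingerOp q) (conj (lam₀ ^ 2)) g, ?_, ?_⟩
      · rw [← hz']
        exact SchrodingerNode.cayley_mem_sup hq hL
          (by rw [hz', Complex.conj_im]; exact neg_ne_zero.2 hz0)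
          (by rw [hz', Complex.conj_conj]) hx₀ hn hm hb he (hn.ne_zero nn) (hb.ne_zero nb) hg
      · change u _ = g
        rw [hu]
        exact SchrodingerNode.cayley_cayley_conj hL hz0 g
  obtain ⟨N, B₁, B₂, hNK, hB₁0, hB₁1, hB₂0, hB₂1, hNU⟩ :=
    SchrodingerNode.exists_unitaryNode u hK nn nb ne nm
      (SchrodingerNode.inner_eq_zero_of_mem_l2On (SchrodingerNode.volume_Iic_inter_Ici hx₀) on ob)
      (SchrodingerNode.inner_eq_zero_of_mem_l2On
        (inter_comm (Iic 0) (Ici x₀) ▸ SchrodingerNode.volume_Iic_inter_Ici hx₀) oe om) h₁ h₂ hmap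
  have hU : ∀ f : ↥(N.K ⊔ N.E₁), (N.U f : SchrodingerNode.L2) =
      SchrodingerNode.cayley (SchrodingerNode.schrodingerOp q) (lam₀ ^ 2) f := fun f => by
    rw [hNU, hu]
  refine ⟨N, B₁, B₂, hNK, hB₁0, hB₁1, hB₂0, hB₂1, hU,
    fun ζ hζ => N.isUnit_pencil (hNK ▸ hK) hζ,
    fun lam hlam => SchrodingerNode.norm_spectralVar_lt_one hz hlam, fun lam hlam hunit => ?_⟩
  refine N.transferMatrix_eq_of_forall B₁ B₂ _ fun c d => ?_
  have hr : lam ^ 2 - conj lam₀ ^ 2 ≠ 0 := sub_ne_zero.2 hlam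
  obtain ⟨k, hk, h, hh, hUh⟩ := N.exists_map_eq_add_charFun hunit (c • B₁ 0 + d • B₁ 1)
  rw [N.charFun_apply_eq B₁ B₂, hU, hh] at hUh
  -- With `ζ = p / r`, the state `k / r` turns `u (ζ k + e) = k + Θ(ζ) e` into the homogeneous form
  -- `u (p k + …) = r k + …`. The two vectors are (first input, second output) and (first output,
  -- second input).
  refine (hiff lam ![_, _] ![_, _]).1 ⟨(lam ^ 2 - conj lam₀ ^ 2)⁻¹ • k,
    Submodule.smul_mem _ _ (hNK ▸ hk), ?_⟩
  simp only [Submodule.coe_add, Submodule.coe_smul, hB₁0, hB₁1, hB₂0, hB₂1] at hUh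
  rw [smul_smul, smul_smul, mul_inv_cancel₀ hr, one_smul, ← div_eq_mul_inv, add_assoc, add_assoc]
  exact hUh
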